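/- Four point vortices with real vorticities $\Gamma_1,\Gamma_2,\Gamma_3,\Gamma_4$ sit at points $z_1,\dots,z_4\in\mathbb{C}$; put $V_n=\sum_{j\ne n}\Gamma_j/\overline{(z_n-z_j)}$, $\Gamma=\sum_j\Gamma_j$ and $L=\sum_{j<k}\Gamma_j\Gamma_k$. A configuration $z=(z_1,\dots,z_4)$ of four distinct points is a *central configuration* if there are $\Lambda\in\mathbb{C}\setminus\{0\}$ and $z_0\in\mathbb{C}$ with $V_n=\Lambda(z_n-z_0)$ for $n=1,\dots,4$ (a relative equilibrium if $\Lambda\in\mathbb{R}\setminus\{0\}$, a collapse configuration if $\Lambda\notin\mathbb{R}$). Configurations $z,z'$ are *equivalent* if $z'_n=b(z_n+a)$ for all $n$, for some $a,b\in\mathbb{C}$ with $b\neq0$. A *normalized central configuration in the complex domain* with multiplier $\Lambda\in\mathbb{C}$, $|\Lambda|=1$, is a system of complex numbers $z_n,w_n$ $(1\le n\le 4)$ and $Z_{jk}=-Z_{kj}$, $W_{jk}=-W_{kj}$ $(1\le j,k\le 4)$ such that $$\Lambda z_n=\sum_{j\ne n}\Gamma_jZ_{jn},\qquad \overline{\Lambda}\,w_n=\sum_{j\neq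 n}\Gamma_jW_{jn}\qquad(1\le n\le 4),$$ $$Z_{jk}(w_k-w_j)=1,\qquad W_{jk}(z_k-z_j)=1\qquad(1\le j<k\le4),\qquad z_2-z_1=w_2-w_1.$$ **Theorem.** Suppose that $\Gamma_1,\Gamma_2,\Gamma_3,\Gamma_4\in\mathbb{R}\setminus\{0\}$, $\Gamma\ne0$ and $L\neq0$, and that it is not the case that three of the vorticities are all equal to $-\tfrac12$ times the remaining one (as in $-\tfrac12\Gamma_1=\Gamma_2=\Gamma_3=\Gamma_4$). Then there are only finitely many normalized central configurations in the complex domain, counted over all multipliers $\Lambda$ with $|\Lambda|=1$. Moreover, the central configurations $z\in\mathbb{C}^4$ form only finitely many equivalence classes. -/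

import Mathlib

open scoped ComplexConjugate

namespace FourVortex

noncomputable section

/-- Total vorticity `Γ = ∑ j, Γ_j`. -/
def totalVorticity {N : ℕ} (Γ : Fin N → ℝ) : ℝ := ∑ j, Γ j

/-- Total vortex angular momentum `L = ∑_{j < k} Γ_j Γ_k`. -/
def angularMomentum {N : ℕ} (Γ : Fin N → ℝ) : ℝ :=
  ∑ j, ∑ k ∈ Finset.Ioi j, Γ j * Γ k

/-- The vector field `V_n = ∑_{j ≠ n} Γ_j / conj (z_n - z_j)`; the vortices at the points
`z_n` of the plane `ℂ`, with vorticities `Γ_n`, move by `dz_n/dt = - i V_n`. -/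
def V {N : ℕ} (Γ : Fin N → ℝ) (z : Fin N → ℂ) (n : Fin N) : ℂ :=
  ∑ j ∈ Finset.univ.erase n, (Γ j : ℂ) / conj (z n - z j)

/-- A collision-free configuration is a relative equilibrium if `V_n = r (z_n - z₀)` for all `n`,
for some nonzero real `r` and some `z₀`. -/
def IsRelativeEquilibrium {N : ℕ} (Γ : Fin N → ℝ) (z : Fin N → ℂ) : Prop :=
  Function.Injective z ∧
    ∃ (r : ℝ) (z₀ : ℂ), r ≠ 0 ∧ ∀ n, V Γ z n = (r : ℂ) * (z n - z₀)

/-- A collision-free configuration is a collapse configuration if `V_n = Λ (z_n - z₀)` for all `n`,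
for some non-real `Λ` and some `z₀`. -/
def IsCollapseConfiguration {N : ℕ} (Γ : Fin N → ℝ) (z : Fin N → ℂ) : Prop :=
  Function.Injective z ∧
    ∃ (Λ z₀ : ℂ), Λ.im ≠ 0 ∧ ∀ n, V Γ z n = Λ * (z n - z₀)

/-- Central configurations: relative equilibria and collapse configurations. -/
def IsCentralConfiguration {N : ℕ} (Γ : Fin N → ℝ) (z : Fin N → ℂ) : Prop :=
  IsRelativeEquilibrium Γ z ∨ IsCollapseConfiguration Γ z

/-- Two configurations are equivalent if they differ by a translation, a rotation and a
dilation: `z'_n = b (z_n + a)` for all `n`, with `b ≠ 0`. -/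
def Equivalent {N : ℕ} (z z' : Fin N → ℂ) : Prop :=
  ∃ a b : ℂ, b ≠ 0 ∧ ∀ n, z' n = b * (z n + a)

theorem equivalent_equivalence (N : ℕ) : Equivalence (@Equivalent N) where
  refl z := ⟨0, 1, one_ne_zero, fun n => by simp⟩
  symm := by
    rintro z z' ⟨a, b, hb, h⟩
    refine ⟨-(b * a), b⁻¹, inv_ne_zero hb, fun n => ?_⟩
    rw [h n]
    field_simp
    ring
  trans := by
    rintro x y z ⟨a, b, hb, h⟩ ⟨c, d, hd, h'⟩
    refine ⟨a + c / b, d * b, mul_ne_zero hd hb, fun n => ?_⟩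
    rw [h' n, h n]
    field_simp
    ring

/-- The equivalence of configurations as a setoid. -/
def configurationSetoid (N : ℕ) : Setoid (Fin N → ℂ) :=
  ⟨Equivalent, equivalent_equivalence N⟩

/-- The variables `(z_n, Z_jk, w_n, W_jk)` of the complexified problem. The families `Z` and `W`
are indexed by all ordered pairs; the entries with `j ≥ k` are determined by antisymmetry
in `IsNormalizedCentralConfiguration`. -/
@[ext]
structure ComplexConfiguration where
  z : Fin 4 → ℂ
  Z : Fin 4 → Fin 4 → ℂ
  w : Fin 4 → ℂ
  W : Fin 4 → Fin 4 → ℂ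

/-- Normalized central configurations, with multiplier `Λ` of modulus one, of the four-vortex
problem in the complex domain. The indices `0, 1, 2, 3` stand for the vortices `1, 2, 3, 4`, and
`z_jk = z_k - z_j`, `w_jk = w_k - w_j`. -/
structure IsNormalizedCentralConfiguration (Γ : Fin 4 → ℝ) (Λ : ℂ)
    (Q : ComplexConfiguration) : Prop where
  norm_multiplier : ‖Λ‖ = 1
  eq_z : ∀ n, Λ * Q.z n = ∑ j ∈ Finset.univ.erase n, (Γ j : ℂ) * Q.Z j n
  eq_w : ∀ n, conj Λ * Q.w n = ∑ j ∈ Finset.univ.erase n, (Γ j : ℂ) * Q.W j n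
  Z_mul : ∀ j k, j < k → Q.Z j k * (Q.w k - Q.w j) = 1
  W_mul : ∀ j k, j < k → Q.W j k * (Q.z k - Q.z j) = 1
  Z_antisymm : ∀ j k, Q.Z j k = -Q.Z k j
  W_antisymm : ∀ j k, Q.W j k = -Q.W k j
  rotation_normalized : Q.z 1 - Q.z 0 = Q.w 1 - Q.w 0

end

end FourVortex

/-! Pairing the two families of equations with `Γ_n w_n` and `Γ_n z_n` gives `Λ I = L = conj Λ * I`,
where `I = ∑ Γ_n z_n w_n`. Since `L ≠ 0`, the multiplier is real, hence `±1`, and collapse is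
impossible for the same reason. With the sign absorbed in `z`, the system is symmetric in `z` and
`w` and invariant under `(z, w) ↦ (t z, t⁻¹ w)`.

The crux is that the scale-invariant products `(z_i - z_j) (w_i - w_j)` take only finitely many
values (`finite_range_sub_mul_sub`). Otherwise an ultrafilter turns the solutions into one solution
over a field of germs in which some product is not algebraic over `ℝ`, and so is infinite at a place
trivial on `ℝ`. But the products are finite at every place (`finite_sub_mul_sub`). To see this,
rescale so that the largest difference of the `w_n` is `1`; then `w` has a nonconstant limit. If `z`
is not finite, some points of this limit coincide. Rescaling by a small distance and exchanging `z`
and `w` turns one collision into another, and comparing leading terms rules out one pair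
(`not_one_collision`), two pairs (`not_two_pairs`) and a triple (`not_triple_collision_aux`).

Given the products, the normalization leaves finitely many `z_1 - z_0`, a quadratic equation then
gives each `z_i - z_0`, and `Γ ≠ 0` fixes the translation by `∑ Γ_n z_n = 0`. -/

namespace FourVortex

/-! ### Places trivial on the real constants -/

/-- A place of the field `K` with values in `k ∪ {∞}`, trivial on the real constants, given by the
relation `Lim x a`: the value of `x` is finite and equal to `a`. -/
structure Place (K k : Type*) [Field K] [Field k] [Algebra ℝ K] [Algebra ℝ k] where
  Lim : K → k → Prop
  const (r : ℝ) : Lim (algebraMap ℝ K r) (algebraMap ℝ k r)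
  add {x y : K} {a b : k} : Lim x a → Lim y b → Lim (x + y) (a + b)
  mul {x y : K} {a b : k} : Lim x a → Lim y b → Lim (x * y) (a * b)
  inv {x : K} {a : k} : Lim x a → a ≠ 0 → Lim x⁻¹ a⁻¹
  unique {x : K} {a b : k} : Lim x a → Lim x b → a = b
  finite_or (x : K) : (∃ a, Lim x a) ∨ Lim x⁻¹ 0

/-- The place defined by a valuation subring that contains the real constants. -/
noncomputable def placeOfValuationSubring {K : Type*} [Field K] [Algebra ℝ K]
    (V : ValuationSubring K) (φ : ℝ →+* V)
    (hφ : ∀ r, (φ r : K) = algebraMap ℝ K r) :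
    letI : Algebra ℝ (IsLocalRing.ResidueField V) := ((IsLocalRing.residue V).comp φ).toAlgebra
    Place K (IsLocalRing.ResidueField V) :=
  letI : Algebra ℝ (IsLocalRing.ResidueField V) := ((IsLocalRing.residue V).comp φ).toAlgebra
  { Lim := fun x a => ∃ y : V, (y : K) = x ∧ IsLocalRing.residue V y = a
    const := fun r => ⟨φ r, hφ r, rfl⟩
    add := by
      rintro _ _ _ _ ⟨x, rfl, rfl⟩ ⟨y, rfl, rfl⟩
      exact ⟨x + y, rfl, map_add _ _ _⟩
    mul := by
      rintro _ _ _ _ ⟨x, rfl, rfl⟩ ⟨y, rfl, rfl⟩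
      exact ⟨x * y, rfl, map_mul _ _ _⟩
    inv := by
      rintro _ _ ⟨x, rfl, rfl⟩ h
      obtain ⟨u, rfl⟩ := (IsLocalRing.residue_ne_zero_iff_isUnit x).1 h
      refine ⟨((u⁻¹ : Vˣ) : V), ?_, ?_⟩
      · refine eq_inv_of_mul_eq_one_left ?_
        exact congrArg Subtype.val (Units.inv_mul u)
      · refine eq_inv_of_mul_eq_one_left ?_
        rw [← map_mul, Units.inv_mul, map_one]
    unique := by
      rintro _ _ _ ⟨x, rfl, rfl⟩ ⟨y, hy, rfl⟩
      rw [Subtype.ext hy]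
    finite_or := by
      intro x
      by_cases hx : x ∈ V
      · exact Or.inl ⟨_, ⟨x, hx⟩, rfl, rfl⟩
      · have hx' : x⁻¹ ∈ V := (V.mem_or_inv_mem x).resolve_left hx
        refine Or.inr ⟨⟨x⁻¹, hx'⟩, rfl, ?_⟩
        by_contra h
        obtain ⟨u, hu⟩ := (IsLocalRing.residue_ne_zero_iff_isUnit _).1 h
        apply hx
        have h1 := congrArg (Subtype.val) (Units.inv_mul u)
        have h2 : ((u : V) : K) = x⁻¹ := congrArg Subtype.val hu
        have h3 : (((u⁻¹ : Vˣ) : V) : K) * x⁻¹ = 1 := by rw [← h2]; exact h1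
        have : x = (((u⁻¹ : Vˣ) : V) : K) := by
          rw [eq_comm, ← inv_inv x]; exact eq_inv_of_mul_eq_one_left h3
        rw [this]; exact SetLike.coe_mem _ }

namespace Place

variable {K k : Type*} [Field K] [Field k] [Algebra ℝ K] [Algebra ℝ k] (P : Place K k)
  {x y t : K} {a b : k}

variable {P}

theorem zero : P.Lim 0 0 := by simpa using P.const 0

theorem one : P.Lim 1 1 := by simpa using P.const 1

theorem neg (h : P.Lim x a) : P.Lim (-x) (-a) := by
  simpa using P.mul (P.const (-1)) h

theorem sub (h : P.Lim x a) (h' : P.Lim y b) : P.Lim (x - y) (a - b) := by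
  simpa only [sub_eq_add_neg] using P.add h (neg h')

theorem div (h : P.Lim x a) (h' : P.Lim y b) (hb : b ≠ 0) : P.Lim (x / y) (a / b) := by
  simpa only [div_eq_mul_inv] using P.mul h (P.inv h' hb)

theorem congr (h : P.Lim x a) (hx : x = y) (ha : a = b) : P.Lim y b := hx ▸ ha ▸ h

theorem ne_zero (h : P.Lim x a) (ha : a ≠ 0) : x ≠ 0 := by
  rintro rfl; exact ha (P.unique h zero)

theorem sum {ι : Type*} (s : Finset ι) {f : ι → K} {g : ι → k} (h : ∀ i ∈ s, P.Lim (f i) (g i)) :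
    P.Lim (∑ i ∈ s, f i) (∑ i ∈ s, g i) := by
  classical
  induction s using Finset.induction_on with
  | empty => simpa using zero
  | insert i s hi ih =>
    rw [Finset.sum_insert hi, Finset.sum_insert hi]
    exact P.add (h i (by simp)) (ih fun j hj => h j (by simp [hj]))

/-- If `t → 0` and `t x` has a nonzero limit then `x⁻¹ → 0`. -/
theorem inv_zero (ht : P.Lim t 0) (ht0 : t ≠ 0) (h : P.Lim (t * x) a) (ha : a ≠ 0) :
    P.Lim x⁻¹ 0 := by
  refine congr (P.mul ht (P.inv h ha)) ?_ (by ring)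
  rw [mul_inv, ← mul_assoc, mul_inv_cancel₀ ht0, one_mul]

/-- Among finitely many elements, not all zero, one dominates the others. -/
theorem exists_dominant {ι : Type*} [Finite ι] (f : ι → K) (hf : ∃ i, f i ≠ 0) :
    ∃ i, f i ≠ 0 ∧ ∀ j, ∃ c, P.Lim (f j / f i) c := by
  classical
  cases nonempty_fintype ι
  suffices H : ∀ s : Finset ι, (∃ i ∈ s, f i ≠ 0) →
      ∃ i ∈ s, f i ≠ 0 ∧ ∀ j ∈ s, ∃ c, P.Lim (f j / f i) c by
    obtain ⟨i, -, hi, h⟩ := H Finset.univ (by simpa using hf)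
    exact ⟨i, hi, fun j => h j (Finset.mem_univ j)⟩
  intro s
  induction s using Finset.induction_on with
  | empty => simp
  | insert i s hi ih =>
    intro hs
    by_cases h : ∃ j ∈ s, f j ≠ 0
    · obtain ⟨m, hm, hm0, hmax⟩ := ih h
      rcases P.finite_or (f i / f m) with hc | hc
      · refine ⟨m, by simp [hm], hm0, fun j hj => ?_⟩
        rcases Finset.mem_insert.1 hj with rfl | hj
        exacts [hc, hmax j hj]
      · by_cases hi0 : f i = 0
        · refine ⟨m, by simp [hm], hm0, fun j hj => ?_⟩
          rcases Finset.mem_insert.1 hj with rfl | hj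
          exacts [⟨0, by simpa [hi0] using zero⟩, hmax j hj]
        refine ⟨i, by simp, hi0, fun j hj => ?_⟩
        rcases Finset.mem_insert.1 hj with rfl | hj
        · exact ⟨1, by simpa [hi0] using one⟩
        · obtain ⟨c, h1⟩ := hmax j hj
          refine ⟨c * 0, congr (P.mul h1 hc) ?_ rfl⟩
          field_simp
    · push Not at h
      obtain ⟨j, hj, hj0⟩ := hs
      have : j = i := by
        rcases Finset.mem_insert.1 hj with hj | hj
        exacts [hj, absurd (h j hj) hj0]
      subst this
      refine ⟨j, hj, hj0, fun l hl => ?_⟩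
      rcases Finset.mem_insert.1 hl with rfl | hl
      · exact ⟨1, by simpa [hj0] using one⟩
      · exact ⟨0, by simpa [h l hl] using zero⟩

end Place

end FourVortex

/-! ### The symmetric system, its limits at a place, and collisions of one pair -/

namespace FourVortex

/-- The equations of the four-vortex problem over a field, the sign of the multiplier being absorbed
in `z`. The terms with `j = n` vanish. -/
structure IsSystem {K : Type*} [Field K] (G : Fin 4 → K) (z w : Fin 4 → K) : Prop where
  z_inj : Function.Injective z
  w_inj : Function.Injective w
  eq_z : ∀ n, z n = ∑ j, G j * (w n - w j)⁻¹
  eq_w : ∀ n, w n = ∑ j, G j * (z n - z j)⁻¹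

namespace IsSystem

variable {K : Type*} [Field K] {G z w : Fin 4 → K}

theorem swap (h : IsSystem G z w) : IsSystem G w z := ⟨h.w_inj, h.z_inj, h.eq_w, h.eq_z⟩

theorem perm (h : IsSystem G z w) (σ : Equiv.Perm (Fin 4)) :
    IsSystem (G ∘ σ) (z ∘ σ) (w ∘ σ) where
  z_inj := h.z_inj.comp σ.injective
  w_inj := h.w_inj.comp σ.injective
  eq_z n := (h.eq_z (σ n)).trans (Equiv.sum_comp σ fun j => G j * (w (σ n) - w j)⁻¹).symm
  eq_w n := (h.eq_w (σ n)).trans (Equiv.sum_comp σ fun j => G j * (z (σ n) - z j)⁻¹).symm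

/-- This symmetry lets any chosen difference of the `w_n` become the unit of length, at the cost of
the inverse factor on `z`. -/
theorem scale (h : IsSystem G z w) {t : K} (ht : t ≠ 0) :
    IsSystem G (fun n => t * z n) (fun n => t⁻¹ * w n) where
  z_inj := (mul_right_injective₀ ht).comp h.z_inj
  w_inj := (mul_right_injective₀ (inv_ne_zero ht)).comp h.w_inj
  eq_z n := by
    rw [h.eq_z n, Finset.mul_sum]
    refine Finset.sum_congr rfl fun j _ => ?_
    rw [← mul_sub, mul_inv, inv_inv]; ring
  eq_w n := by
    rw [h.eq_w n, Finset.mul_sum]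
    refine Finset.sum_congr rfl fun j _ => ?_
    rw [← mul_sub, mul_inv]; ring

theorem z_sub_ne (h : IsSystem G z w) {i j : Fin 4} (hij : i ≠ j) : z i - z j ≠ 0 :=
  sub_ne_zero.2 fun e => hij (h.z_inj e)

theorem w_sub_ne (h : IsSystem G z w) {i j : Fin 4} (hij : i ≠ j) : w i - w j ≠ 0 :=
  h.swap.z_sub_ne hij

theorem z_zero (h : IsSystem G z w) :
    z 0 = G 1 * (w 0 - w 1)⁻¹ + G 2 * (w 0 - w 2)⁻¹ + G 3 * (w 0 - w 3)⁻¹ := by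
  simpa [Fin.sum_univ_four] using h.eq_z 0

theorem z_one (h : IsSystem G z w) :
    z 1 = G 0 * (w 1 - w 0)⁻¹ + G 2 * (w 1 - w 2)⁻¹ + G 3 * (w 1 - w 3)⁻¹ := by
  simpa [Fin.sum_univ_four] using h.eq_z 1

theorem z_two (h : IsSystem G z w) :
    z 2 = G 0 * (w 2 - w 0)⁻¹ + G 1 * (w 2 - w 1)⁻¹ + G 3 * (w 2 - w 3)⁻¹ := by
  simpa [Fin.sum_univ_four] using h.eq_z 2

theorem z_three (h : IsSystem G z w) :
    z 3 = G 0 * (w 3 - w 0)⁻¹ + G 1 * (w 3 - w 1)⁻¹ + G 2 * (w 3 - w 2)⁻¹ := by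
  simpa [Fin.sum_univ_four] using h.eq_z 3

/-- The pair interactions are antisymmetric, so they cancel. -/
theorem sum_mul_z (h : IsSystem G z w) : ∑ n, G n * z n = 0 := by
  have flip : ∀ i j, (w j - w i)⁻¹ = -(w i - w j)⁻¹ := fun i j => by rw [← inv_neg, neg_sub]
  rw [Fin.sum_univ_four, h.z_zero, h.z_one, h.z_two, h.z_three, flip 0 1, flip 0 2, flip 0 3,
    flip 1 2, flip 1 3, flip 2 3]
  ring

end IsSystem

/-- The vorticities as elements `G i` of `K`, with values `γ i`, and the properties of them that are
used: they are nonzero real numbers with nonzero total. -/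
structure Weights {K k : Type*} [Field K] [Field k] [Algebra ℝ K] [Algebra ℝ k] (P : Place K k)
    (G : Fin 4 → K) (γ : Fin 4 → k) : Prop where
  lim : ∀ i, P.Lim (G i) (γ i)
  ne : ∀ i, γ i ≠ 0
  total : ∑ i, γ i ≠ 0
  pair : ∀ i j, γ i + γ j = 0 → G i + G j = 0
  triple : ∀ i j l, γ i + γ j + γ l = 0 → G i + G j + G l = 0
  momentum : ∀ i j l, γ i * γ j + γ i * γ l + γ j * γ l = 0 →
    G i * G j + G i * G l + G j * G l = 0
  prod : ∀ i j l m, γ i * γ j = γ l * γ m → G i * G j = G l * G m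
  momentum_ne : ∀ i j l, γ i + γ j + γ l = 0 → γ i * γ j + γ i * γ l + γ j * γ l ≠ 0

section

variable {K k : Type*} [Field K] [Field k] [Algebra ℝ K] [Algebra ℝ k] {P : Place K k}
  {G : Fin 4 → K} {γ : Fin 4 → k} {z w : Fin 4 → K} {ω ζ : Fin 4 → k}

/-- Relations among residues lift to exact relations in `K` because both come from the same real
numbers. The last property is where reality of the vorticities matters: if `e₁ = e₂ = 0` then `e₁² -
2 e₂`, a sum of squares, vanishes. -/
theorem weights_of_real (P : Place K k) {Γ : Fin 4 → ℝ} (hne : ∀ i, Γ i ≠ 0)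
    (htot : ∑ i, Γ i ≠ 0) :
    Weights P (fun i => algebraMap ℝ K (Γ i)) (fun i => algebraMap ℝ k (Γ i)) := by
  have inj := (algebraMap ℝ k).injective
  have zero_of : ∀ {r : ℝ}, algebraMap ℝ k r = 0 → r = 0 := fun h => by simpa using h
  refine ⟨fun i => P.const _, fun i h => hne i (zero_of h), ?_, ?_, ?_, ?_, ?_, ?_⟩
  · rw [← map_sum]; exact fun h => htot (zero_of h)
  · intro i j; simp only [← map_add]; intro h; rw [zero_of h, map_zero]
  · intro i j l; simp only [← map_add]; intro h; rw [zero_of h, map_zero]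
  · intro i j l; simp only [← map_add, ← map_mul]; intro h; rw [zero_of h, map_zero]
  · intro i j l m; simp only [← map_mul]; intro h; rw [inj h]
  · intro i j l; simp only [← map_add, ← map_mul]; intro h h'
    have h1 := zero_of h
    have h2 := zero_of h'
    have h3 := hne i
    have : Γ i ^ 2 + Γ j ^ 2 + Γ l ^ 2 = 0 := by
      linear_combination (Γ i + Γ j + Γ l) * h1 - 2 * h2
    have : 0 < Γ i ^ 2 := by positivity
    nlinarith [sq_nonneg (Γ j), sq_nonneg (Γ l)]

namespace Weights

theorem perm (W : Weights P G γ) (σ : Equiv.Perm (Fin 4)) : Weights P (G ∘ σ) (γ ∘ σ) where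
  lim i := W.lim _
  ne i := W.ne _
  total := by
    have := W.total
    rwa [← Equiv.sum_comp σ] at this
  pair i j := W.pair _ _
  triple i j l := W.triple _ _ _
  momentum i j l := W.momentum _ _ _
  prod i j l m := W.prod _ _ _ _
  momentum_ne i j l := W.momentum_ne _ _ _

theorem total_four (W : Weights P G γ) : γ 0 + γ 1 + γ 2 + γ 3 ≠ 0 := by
  simpa [Fin.sum_univ_four] using W.total

theorem G_ne (W : Weights P G γ) (i : Fin 4) : G i ≠ 0 := Place.ne_zero (W.lim i) (W.ne i)

end Weights

theorem exists_perm {i j l m : Fin 4} (hij : i ≠ j) (hil : i ≠ l) (him : i ≠ m) (hjl : j ≠ l)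
    (hjm : j ≠ m) (hlm : l ≠ m) :
    ∃ σ : Equiv.Perm (Fin 4), σ 0 = i ∧ σ 1 = j ∧ σ 2 = l ∧ σ 3 = m := by
  have inj : Function.Injective ![i, j, l, m] := by
    intro a b
    fin_cases a <;> fin_cases b <;> simp_all [eq_comm]
  exact ⟨Equiv.ofBijective _ (Finite.injective_iff_bijective.1 inj), rfl, rfl, rfl, rfl⟩

/-- Using limits of the inverses admits points that recede to infinity, whose inverse differences
tend to `0`. For `j = n` the inverse is that of `0`, namely `0`. -/
theorem IsSystem.lim_z_of_inv (h : IsSystem G z w) (W : Weights P G γ) (n : Fin 4) (c : Fin 4 → k)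
    (hc : ∀ j, P.Lim (w n - w j)⁻¹ (c j)) : P.Lim (z n) (∑ j, γ j * c j) := by
  rw [h.eq_z n]
  exact Place.sum _ fun j _ => P.mul (W.lim j) (hc j)

theorem IsSystem.lim_z (h : IsSystem G z w) (W : Weights P G γ) (hw : ∀ n, P.Lim (w n) (ω n))
    (n : Fin 4) (hn : ∀ j, j ≠ n → ω n ≠ ω j) : P.Lim (z n) (∑ j, γ j * (ω n - ω j)⁻¹) := by
  refine h.lim_z_of_inv W n _ fun j => ?_
  by_cases hj : j = n
  · subst hj; simpa using Place.zero
  · exact P.inv (Place.sub (hw n) (hw j)) (sub_ne_zero.2 (hn j hj))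

theorem IsSystem.sum_mul_lim_z (h : IsSystem G z w) (W : Weights P G γ)
    (hz : ∀ n, P.Lim (z n) (ζ n)) : γ 0 * ζ 0 + γ 1 * ζ 1 + γ 2 * ζ 2 + γ 3 * ζ 3 = 0 := by
  rw [← Fin.sum_univ_four fun n => γ n * ζ n]
  refine P.unique (Place.sum _ fun n _ => P.mul (W.lim n) (hz n)) ?_
  rw [h.sum_mul_z]; exact Place.zero

/-- If `w` tends to a configuration with distinct points then `z` has a finite limit. -/
theorem IsSystem.finite_z_of_injective (h : IsSystem G z w) (W : Weights P G γ)
    (hw : ∀ n, P.Lim (w n) (ω n)) (hω : Function.Injective ω) (n : Fin 4) :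
    ∃ c, P.Lim (z n) c :=
  ⟨_, h.lim_z W hw n fun _ hj e => hj (hω e).symm⟩

/-- If `t → 0` and `w` has a nonconstant limit then `w / t` is not finite. -/
theorem not_finite_of_scaled {t : K} (ht0 : t ≠ 0) (ht : P.Lim t 0) (hw : ∀ n, P.Lim (w n) (ω n))
    {i j : Fin 4} (hij : ω i ≠ ω j) : ¬ ∀ n, ∃ c, P.Lim (t⁻¹ * w n) c := by
  intro hf
  have key : ∀ n, ω n = 0 := by
    intro n
    obtain ⟨c, hc⟩ := hf n
    refine P.unique (hw n) (Place.congr (P.mul ht hc) ?_ (zero_mul _))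
    field_simp
  exact hij ((key i).trans (key j).symm)

/-- Let `α = w_0 - w_1`; then `α z → (γ_1, -γ_0, 0, 0)`. If `γ_0 + γ_1 = 0`, the singular terms of
`z_0 - z_1` cancel and `z_0 - z_1 → 0`, while `z_2` and `z_3` are infinitely far from `z_0`;
multiplying the equation of `w_0` by `z_0 - z_1` gives `γ_1 = 0`. Otherwise `w_0 / α` and `w_1 / α`
are finite, so `ω_0 = ω_1 = 0`, and their difference being `1` forces `γ_2 + γ_3 = 0`; then `∑ γ_n
ω_n = 0` gives `ω_2 = ω_3`. -/
theorem not_one_collision_aux (h : IsSystem G z w) (W : Weights P G γ)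
    (hw : ∀ n, P.Lim (w n) (ω n)) (h01 : ω 0 = ω 1) (h02 : ω 0 ≠ ω 2) (h03 : ω 0 ≠ ω 3)
    (h23 : ω 2 ≠ ω 3) : False := by
  have h12 : ω 1 ≠ ω 2 := h01 ▸ h02
  have h13 : ω 1 ≠ ω 3 := h01 ▸ h03
  have hα0 : w 0 - w 1 ≠ 0 := h.w_sub_ne (by decide)
  have hα : P.Lim (w 0 - w 1) 0 := Place.congr (Place.sub (hw 0) (hw 1)) rfl (by rw [h01, sub_self])
  have h' := h.scale hα0
  have far : ∀ i j, ω i ≠ ω j → P.Lim ((w 0 - w 1)⁻¹ * w i - (w 0 - w 1)⁻¹ * w j)⁻¹ 0 := by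
    intro i j hij
    refine Place.congr (P.mul hα (P.inv (Place.sub (hw i) (hw j)) (sub_ne_zero.2 hij))) ?_
      (zero_mul _)
    rw [← mul_sub, mul_inv, inv_inv]
  have e01 : (w 0 - w 1)⁻¹ * w 0 - (w 0 - w 1)⁻¹ * w 1 = 1 := by
    rw [← mul_sub, inv_mul_cancel₀ hα0]
  have l0 : P.Lim ((w 0 - w 1) * z 0) (γ 1) := by
    refine Place.congr (h'.lim_z_of_inv W 0 ![0, 1, 0, 0] fun j => ?_) rfl
      (by simp [Fin.sum_univ_four])
    fin_cases j
    · simpa using Place.zero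
    · simpa [e01] using Place.one
    · exact far _ _ h02
    · exact far _ _ h03
  have l1 : P.Lim ((w 0 - w 1) * z 1) (-γ 0) := by
    refine Place.congr (h'.lim_z_of_inv W 1 ![-1, 0, 0, 0] fun j => ?_) rfl
      (by simp [Fin.sum_univ_four])
    fin_cases j
    · refine Place.congr (Place.neg Place.one) ?_ rfl
      simp only [Fin.zero_eta, ← neg_sub ((w 0 - w 1)⁻¹ * w 0), e01]
      norm_num
    · simpa using Place.zero
    · exact far _ _ h12
    · exact far _ _ h13
  have l2 : P.Lim ((w 0 - w 1) * z 2) 0 := by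
    refine Place.congr (h'.lim_z_of_inv W 2 ![0, 0, 0, 0] fun j => ?_) rfl
      (by simp [Fin.sum_univ_four])
    fin_cases j
    · exact far _ _ h02.symm
    · exact far _ _ h12.symm
    · simpa using Place.zero
    · exact far _ _ h23
  have l3 : P.Lim ((w 0 - w 1) * z 3) 0 := by
    refine Place.congr (h'.lim_z_of_inv W 3 ![0, 0, 0, 0] fun j => ?_) rfl
      (by simp [Fin.sum_univ_four])
    fin_cases j
    · exact far _ _ h03.symm
    · exact far _ _ h13.symm
    · exact far _ _ h23.symm
    · simpa using Place.zero
  have g0 := W.ne 0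
  have g1 := W.ne 1
  by_cases hs : γ 0 + γ 1 = 0
  · have lz : P.Lim (z 0 - z 1) 0 := by
      have := W.pair 0 1 hs
      have key : z 0 - z 1 = G 2 * (w 0 - w 2)⁻¹ + G 3 * (w 0 - w 3)⁻¹ -
          (G 2 * (w 1 - w 2)⁻¹ + G 3 * (w 1 - w 3)⁻¹) := by
        rw [h.z_zero, h.z_one, ← neg_sub (w 0) (w 1), inv_neg]
        linear_combination (w 0 - w 1)⁻¹ * this
      rw [key]
      refine Place.congr (Place.sub (P.add (P.mul (W.lim 2) (P.inv (Place.sub (hw 0) (hw 2))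
        (sub_ne_zero.2 h02))) (P.mul (W.lim 3) (P.inv (Place.sub (hw 0) (hw 3))
        (sub_ne_zero.2 h03)))) (P.add (P.mul (W.lim 2) (P.inv (Place.sub (hw 1) (hw 2))
        (sub_ne_zero.2 h12))) (P.mul (W.lim 3) (P.inv (Place.sub (hw 1) (hw 3))
        (sub_ne_zero.2 h13))))) rfl (by rw [h01]; ring)
    have i2 : P.Lim (z 0 - z 2)⁻¹ 0 :=
      Place.inv_zero hα hα0 (a := γ 1) (Place.congr (Place.sub l0 l2) (by ring) (by ring)) g1
    have i3 : P.Lim (z 0 - z 3)⁻¹ 0 :=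
      Place.inv_zero hα hα0 (a := γ 1) (Place.congr (Place.sub l0 l3) (by ring) (by ring)) g1
    refine g1 (P.unique (W.lim 1) ?_)
    refine Place.congr (Place.sub (P.mul lz (hw 0)) (P.mul lz (P.add (P.mul (W.lim 2) i2)
      (P.mul (W.lim 3) i3)))) ?_ (by ring)
    have h01' := h.z_sub_ne (i := 0) (j := 1) (by decide)
    rw [h.swap.z_zero]
    field_simp
    ring
  · have hz' : ∀ n, P.Lim ((w 0 - w 1) * z n) (![γ 1, -γ 0, 0, 0] n) := by
      intro n; fin_cases n
      exacts [l0, l1, l2, l3]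
    have hs' : γ 1 + γ 0 ≠ 0 := by rwa [add_comm]
    have m0 := h'.swap.lim_z W hz' 0 (by
      intro j hj; fin_cases j <;> simp_all [eq_neg_iff_add_eq_zero])
    have m1 := h'.swap.lim_z W hz' 1 (by
      intro j hj; fin_cases j <;> simp_all [neg_eq_iff_add_eq_zero])
    have hω0 : ω 0 = 0 := by
      refine P.unique (hw 0) (Place.congr (P.mul hα m0) ?_ (zero_mul _))
      field_simp
    have e := P.unique (Place.sub m0 m1) (Place.congr Place.one e01.symm rfl)
    simp [Fin.sum_univ_four] at e
    have hs2 : -γ 0 - γ 1 ≠ 0 := by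
      intro h; apply hs; linear_combination -h
    have e2 : γ 2 + γ 3 = 0 := by
      have : (γ 2 + γ 3) * (γ 1 + γ 0) = 0 := by
        field_simp at e
        grind
      exact (mul_eq_zero.1 this).resolve_right hs'
    have e3 := h.swap.sum_mul_lim_z W hw
    rw [← h01, hω0] at e3
    have : γ 2 * (ω 2 - ω 3) = 0 := by linear_combination e3 - ω 3 * e2
    exact (mul_ne_zero (W.ne 2) (sub_ne_zero.2 h23)) this

/-- The limit of `w` is never a configuration in which exactly one pair of points collides. -/
theorem not_one_collision (h : IsSystem G z w) (W : Weights P G γ)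
    (hw : ∀ n, P.Lim (w n) (ω n)) (i j l m : Fin 4) (hij : i ≠ j) (e : ω i = ω j)
    (hil : ω i ≠ ω l) (him : ω i ≠ ω m) (hlm : ω l ≠ ω m) : False := by
  obtain ⟨σ, rfl, rfl, rfl, rfl⟩ := exists_perm (i := i) (j := j) (l := l) (m := m) hij
    (by rintro rfl; exact hil rfl) (by rintro rfl; exact him rfl)
    (by rintro rfl; exact hil e) (by rintro rfl; exact him e) (by rintro rfl; exact hlm rfl)
  exact not_one_collision_aux (h.perm σ) (W.perm σ) (fun n => hw (σ n)) e hil him hlm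

end

end FourVortex

/-! ### Collisions of two pairs -/

namespace FourVortex

variable {K k : Type*} [Field K] [Field k] [Algebra ℝ K] [Algebra ℝ k] {P : Place K k}
  {G : Fin 4 → K} {γ : Fin 4 → k} {z w : Fin 4 → K} {ω ζ : Fin 4 → k} {κ : k}

/-- If two pairs of points collide in `w`, then `z`, scaled by the first distance, has a limit. -/
theorem lim_scaled_of_two_pairs (h : IsSystem G z w) (W : Weights P G γ)
    (hw : ∀ n, P.Lim (w n) (ω n)) (h01 : ω 0 = ω 1) (h23 : ω 2 = ω 3) (h02 : ω 0 ≠ ω 2)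
    (hκ : P.Lim ((w 0 - w 1) * (w 2 - w 3)⁻¹) κ) (n : Fin 4) :
    P.Lim ((w 0 - w 1) * z n) (![γ 1, -γ 0, κ * γ 3, -(κ * γ 2)] n) := by
  have h03 : ω 0 ≠ ω 3 := h23 ▸ h02
  have h12 : ω 1 ≠ ω 2 := h01 ▸ h02
  have h13 : ω 1 ≠ ω 3 := h01 ▸ h03
  have hα0 : w 0 - w 1 ≠ 0 := h.w_sub_ne (by decide)
  have hα : P.Lim (w 0 - w 1) 0 := Place.congr (Place.sub (hw 0) (hw 1)) rfl (by rw [h01, sub_self])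
  have h' := h.scale hα0
  have far : ∀ i j, ω i ≠ ω j → P.Lim ((w 0 - w 1)⁻¹ * w i - (w 0 - w 1)⁻¹ * w j)⁻¹ 0 := by
    intro i j hij
    refine Place.congr (P.mul hα (P.inv (Place.sub (hw i) (hw j)) (sub_ne_zero.2 hij))) ?_
      (zero_mul _)
    rw [← mul_sub, mul_inv, inv_inv]
  have e01 : (w 0 - w 1)⁻¹ * w 0 - (w 0 - w 1)⁻¹ * w 1 = 1 := by
    rw [← mul_sub, inv_mul_cancel₀ hα0]
  have l23 : P.Lim ((w 0 - w 1)⁻¹ * w 2 - (w 0 - w 1)⁻¹ * w 3)⁻¹ κ := by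
    rwa [← mul_sub, mul_inv, inv_inv]
  fin_cases n
  · refine Place.congr (h'.lim_z_of_inv W 0 ![0, 1, 0, 0] fun j => ?_) rfl
      (by simp [Fin.sum_univ_four])
    fin_cases j
    · simpa using Place.zero
    · simpa [e01] using Place.one
    · exact far _ _ h02
    · exact far _ _ h03
  · refine Place.congr (h'.lim_z_of_inv W 1 ![-1, 0, 0, 0] fun j => ?_) rfl
      (by simp [Fin.sum_univ_four])
    fin_cases j
    · refine Place.congr (Place.neg Place.one) ?_ rfl
      simp only [Fin.zero_eta, ← neg_sub ((w 0 - w 1)⁻¹ * w 0), e01]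
      norm_num
    · simpa using Place.zero
    · exact far _ _ h12
    · exact far _ _ h13
  · refine Place.congr (h'.lim_z_of_inv W 2 ![0, 0, 0, κ] fun j => ?_) rfl
      (by simp [Fin.sum_univ_four, mul_comm])
    fin_cases j
    · exact far _ _ h02.symm
    · exact far _ _ h12.symm
    · simpa using Place.zero
    · exact l23
  · refine Place.congr (h'.lim_z_of_inv W 3 ![0, 0, -κ, 0] fun j => ?_) rfl
      (by simp [Fin.sum_univ_four, mul_comm])
    fin_cases j
    · exact far _ _ h03.symm
    · exact far _ _ h13.symm
    · refine Place.congr (Place.neg l23) ?_ rfl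
      rw [← inv_neg, neg_sub]; rfl
    · simpa using Place.zero

/-- After rescaling, `z` tends to `(γ_1, -γ_0, 0, 0)`, in which only the points `2` and `3`
coincide, so the one-pair result applies with `z` and `w` exchanged. -/
theorem not_two_pairs_of_ratio_zero (h : IsSystem G z w) (W : Weights P G γ)
    (hw : ∀ n, P.Lim (w n) (ω n)) (h01 : ω 0 = ω 1) (h23 : ω 2 = ω 3) (h02 : ω 0 ≠ ω 2)
    (hκ : P.Lim ((w 0 - w 1) * (w 2 - w 3)⁻¹) 0) (hs : γ 0 + γ 1 ≠ 0) : False := by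
  have l := lim_scaled_of_two_pairs h W hw h01 h23 h02 hκ
  have hα0 : w 0 - w 1 ≠ 0 := h.w_sub_ne (by decide)
  refine not_one_collision (h.scale hα0).swap W l 2 3 0 1 (by decide) (by simp) ?_ ?_ ?_
  · simpa using (W.ne 1).symm
  · simpa using W.ne 0
  · simp only [Matrix.cons_val_zero, Matrix.cons_val_one]
    intro e; apply hs; linear_combination e

/-- Seen from `z_2`, the opposite vortices `0` and `1` form a dipole: multiplying the equation of
`w_2` by `z_2 - z_1 → 0` leaves `γ_1 q` as the limit of the dipole term, while all other terms tend
to `0`. -/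
theorem not_opposite_pair_aux (h : IsSystem G z w) (W : Weights P G γ)
    (hw : ∀ n, P.Lim (w n) (ω n)) (h01 : ω 0 = ω 1) (h23 : ω 2 = ω 3)
    (hs : γ 0 + γ 1 = 0) {q : k} (hq : q ≠ 0) (lz : P.Lim (z 0 - z 1) 0)
    (lq : P.Lim ((z 0 - z 1) * (z 0 - z 2)⁻¹) q) (i23 : P.Lim (z 2 - z 3)⁻¹ 0) : False := by
  have hα0 : w 0 - w 1 ≠ 0 := h.w_sub_ne (by decide)
  have n01 := h.z_sub_ne (i := 0) (j := 1) (by decide)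
  have n02 := h.z_sub_ne (i := 0) (j := 2) (by decide)
  have n12 := h.z_sub_ne (i := 1) (j := 2) (by decide)
  have n23 := h.z_sub_ne (i := 2) (j := 3) (by decide)
  have hω2 : ω 2 = 0 := by
    have e := h.swap.sum_mul_lim_z W hw
    rw [← h01, ← h23] at e
    have e1 : (γ 2 + γ 3) * ω 2 = 0 := by linear_combination e - ω 0 * hs
    refine (mul_eq_zero.1 e1).resolve_left fun e2 => W.total_four ?_
    linear_combination hs + e2
  have l20 : P.Lim (z 2 - z 0) 0 := by
    refine Place.congr (Place.neg (P.mul lz (P.inv lq hq))) ?_ (by ring)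
    field_simp
    ring
  have l21 : P.Lim (z 2 - z 1) 0 := Place.congr (P.add l20 lz) (by ring) (by ring)
  have key := Place.sub (P.mul l21 (hw 2)) (P.mul l21 (P.mul (W.lim 3) i23))
  refine mul_ne_zero (W.ne 1) hq (P.unique (P.mul (W.lim 1) lq) (Place.congr key ?_ (by ring)))
  have n20 : z 2 - z 0 ≠ 0 := h.z_sub_ne (by decide)
  have n21 : z 2 - z 1 ≠ 0 := h.z_sub_ne (by decide)
  have hG : G 0 = -G 1 := by linear_combination W.pair 0 1 hs
  rw [h.swap.z_two, hG, ← neg_sub (z 2) (z 0), inv_neg]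
  field_simp
  ring

/-- Since `G 0 + G 1 = 0` exactly, the singular terms cancel, and the remaining terms have equal
limits at the two colliding points. -/
theorem lim_sub_of_opposite_pair (h : IsSystem G z w) (W : Weights P G γ)
    (hw : ∀ n, P.Lim (w n) (ω n)) (h01 : ω 0 = ω 1) (h23 : ω 2 = ω 3) (h02 : ω 0 ≠ ω 2)
    (hs : γ 0 + γ 1 = 0) : P.Lim (z 0 - z 1) 0 := by
  have h03 : ω 0 ≠ ω 3 := h23 ▸ h02
  have h12 : ω 1 ≠ ω 2 := h01 ▸ h02
  have h13 : ω 1 ≠ ω 3 := h01 ▸ h03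
  have := W.pair 0 1 hs
  have key : z 0 - z 1 = G 2 * (w 0 - w 2)⁻¹ + G 3 * (w 0 - w 3)⁻¹ -
      (G 2 * (w 1 - w 2)⁻¹ + G 3 * (w 1 - w 3)⁻¹) := by
    rw [h.z_zero, h.z_one, ← neg_sub (w 0) (w 1), inv_neg]
    linear_combination (w 0 - w 1)⁻¹ * this
  rw [key]
  refine Place.congr (Place.sub (P.add (P.mul (W.lim 2) (P.inv (Place.sub (hw 0) (hw 2))
    (sub_ne_zero.2 h02))) (P.mul (W.lim 3) (P.inv (Place.sub (hw 0) (hw 3))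
    (sub_ne_zero.2 h03)))) (P.add (P.mul (W.lim 2) (P.inv (Place.sub (hw 1) (hw 2))
    (sub_ne_zero.2 h12))) (P.mul (W.lim 3) (P.inv (Place.sub (hw 1) (hw 3))
    (sub_ne_zero.2 h13))))) rfl (by rw [h01]; ring)

theorem charZero_of_real_algebra (k : Type*) [Field k] [Algebra ℝ k] : CharZero k :=
  charZero_of_injective_algebraMap (algebraMap ℝ k).injective

/-- The matching condition says that the rescaled limits of `z_0` and `z_2` agree, so only `z_3` is
known to be far away. The equation of `w_0` times `z_0 - z_1` then determines the ratio `q = -γ_1 /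
γ_2` needed for the dipole argument. -/
theorem not_opposite_pair_of_matching (h : IsSystem G z w) (W : Weights P G γ)
    (hw : ∀ n, P.Lim (w n) (ω n)) (h01 : ω 0 = ω 1) (h23 : ω 2 = ω 3) (h02 : ω 0 ≠ ω 2)
    (hs : γ 0 + γ 1 = 0) (hκ : P.Lim ((w 0 - w 1) * (w 2 - w 3)⁻¹) κ) (e : γ 1 = κ * γ 3) :
    False := by
  have hα0 : w 0 - w 1 ≠ 0 := h.w_sub_ne (by decide)
  have hα : P.Lim (w 0 - w 1) 0 := Place.congr (Place.sub (hw 0) (hw 1)) rfl (by rw [h01, sub_self])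
  have l := lim_scaled_of_two_pairs h W hw h01 h23 h02 hκ
  have lz := lim_sub_of_opposite_pair h W hw h01 h23 h02 hs
  have hκ0 : κ ≠ 0 := by rintro rfl; exact W.ne 1 (by rw [e, zero_mul])
  have hne : γ 1 + κ * γ 2 ≠ 0 := by
    intro e2
    have : κ * (γ 2 + γ 3) = 0 := by linear_combination e2 - e
    have := (mul_eq_zero.1 this).resolve_left hκ0
    exact W.total_four (by linear_combination hs + this)
  have i03 : P.Lim (z 0 - z 3)⁻¹ 0 :=
    Place.inv_zero hα hα0 (Place.congr (Place.sub (l 0) (l 3)) (by ring) (by simp)) hne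
  have i23 : P.Lim (z 2 - z 3)⁻¹ 0 :=
    Place.inv_zero hα hα0 (Place.congr (Place.sub (l 2) (l 3)) (by ring) (by simp [e])) hne
  refine not_opposite_pair_aux h W hw h01 h23 hs (q := -γ 1 / γ 2)
    (div_ne_zero (neg_ne_zero.2 (W.ne 1)) (W.ne 2)) lz ?_ i23
  have g2 := W.G_ne 2
  have n01 := h.z_sub_ne (i := 0) (j := 1) (by decide)
  refine Place.congr (Place.div (Place.sub (Place.sub (P.mul lz (hw 0)) (W.lim 1))
    (P.mul lz (P.mul (W.lim 3) i03))) (W.lim 2) (W.ne 2)) ?_ (by ring)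
  rw [h.swap.z_zero]
  field_simp
  ring

/-- If neither `z_2` nor `z_3` matches `z_0` at the scale of the first pair, the equation of `w_0`
gives `γ_1 = 0`, as for a single collision. If the ratio of distances is infinite, the other pair,
whose total is nonzero, is the much closer one. -/
theorem not_opposite_pair (h : IsSystem G z w) (W : Weights P G γ)
    (hw : ∀ n, P.Lim (w n) (ω n)) (h01 : ω 0 = ω 1) (h23 : ω 2 = ω 3) (h02 : ω 0 ≠ ω 2)
    (hs : γ 0 + γ 1 = 0) : False := by
  have hα0 : w 0 - w 1 ≠ 0 := h.w_sub_ne (by decide)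
  have hα : P.Lim (w 0 - w 1) 0 := Place.congr (Place.sub (hw 0) (hw 1)) rfl (by rw [h01, sub_self])
  have h03 : ω 0 ≠ ω 3 := h23 ▸ h02
  rcases P.finite_or ((w 0 - w 1) * (w 2 - w 3)⁻¹) with ⟨κ, hκ⟩ | hκ
  · by_cases e3 : γ 1 = κ * γ 3
    · exact not_opposite_pair_of_matching h W hw h01 h23 h02 hs hκ e3
    by_cases e2 : γ 1 = -κ * γ 2
    · refine not_opposite_pair_of_matching (h.perm (Equiv.swap 2 3)) (W.perm (Equiv.swap 2 3))
        (ω := ω ∘ Equiv.swap 2 3) (κ := -κ) (fun n => hw _) h01 h23.symm h03 hs ?_ e2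
      refine Place.congr (Place.neg hκ) ?_ rfl
      change _ = (w 0 - w 1) * (w 3 - w 2)⁻¹
      rw [← neg_sub (w 2) (w 3), inv_neg]; ring
    have l := lim_scaled_of_two_pairs h W hw h01 h23 h02 hκ
    have lz := lim_sub_of_opposite_pair h W hw h01 h23 h02 hs
    have i02 : P.Lim (z 0 - z 2)⁻¹ 0 :=
      Place.inv_zero hα hα0 (Place.congr (Place.sub (l 0) (l 2)) (by ring) (by simp))
        (sub_ne_zero.2 e3)
    have i03 : P.Lim (z 0 - z 3)⁻¹ 0 :=
      Place.inv_zero hα hα0 (Place.congr (Place.sub (l 0) (l 3)) (by ring) (by simp))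
        (a := γ 1 - -κ * γ 2) (sub_ne_zero.2 e2)
    refine W.ne 1 (P.unique (W.lim 1) ?_)
    refine Place.congr (Place.sub (P.mul lz (hw 0)) (P.mul lz (P.add (P.mul (W.lim 2) i02)
      (P.mul (W.lim 3) i03)))) ?_ (by ring)
    have h01' := h.z_sub_ne (i := 0) (j := 1) (by decide)
    rw [h.swap.z_zero]
    field_simp
    ring
  · let σ : Equiv.Perm (Fin 4) := Equiv.swap 0 2 * Equiv.swap 1 3
    refine not_two_pairs_of_ratio_zero (h.perm σ) (W.perm σ) (ω := ω ∘ σ) (fun n => hw _) h23 h01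
      h02.symm ?_ ?_
    · rw [mul_inv, inv_inv, mul_comm] at hκ
      exact hκ
    · change γ 2 + γ 3 ≠ 0
      intro e; exact W.total_four (by linear_combination hs + e)

/-- Here the rescaled `z` collides in the pairs `02` and `13`. The equations of `w_0` and `w_1` give
`z_0 - z_2 → γ_2 / ω_0` and `z_1 - z_3 → γ_3 / ω_0`. In `G_0 (z_0 - z_2) + G_1 (z_1 - z_3)` the
singular terms cancel since `G_1 G_2 = G_0 G_3`, so its limit can also be computed from the far
interactions. The two values are `κ (γ_2² + γ_3²) / ω_0` and `κ (γ_2 + γ_3)² / ω_0`. -/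
theorem not_two_pairs_matching (h : IsSystem G z w) (W : Weights P G γ)
    (hw : ∀ n, P.Lim (w n) (ω n)) (h01 : ω 0 = ω 1) (h23 : ω 2 = ω 3) (h02 : ω 0 ≠ ω 2)
    (hs : γ 0 + γ 1 ≠ 0) (hκ : P.Lim ((w 0 - w 1) * (w 2 - w 3)⁻¹) κ) (hκ0 : κ ≠ 0)
    (e1 : γ 1 = κ * γ 3) (e0 : γ 0 = κ * γ 2) : False := by
  have h03 : ω 0 ≠ ω 3 := h23 ▸ h02
  have h12 : ω 1 ≠ ω 2 := h01 ▸ h02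
  have h13 : ω 1 ≠ ω 3 := h01 ▸ h03
  have hα0 : w 0 - w 1 ≠ 0 := h.w_sub_ne (by decide)
  have l := lim_scaled_of_two_pairs h W hw h01 h23 h02 hκ
  have hs' : γ 1 + γ 0 ≠ 0 := by rwa [add_comm]
  have n02 := h.z_sub_ne (i := 0) (j := 2) (by decide)
  have n13 := h.z_sub_ne (i := 1) (j := 3) (by decide)
  have ratio : ∀ i j m, ((![γ 1, -γ 0, κ * γ 3, -(κ * γ 2)] : Fin 4 → k) i =
      (![γ 1, -γ 0, κ * γ 3, -(κ * γ 2)] : Fin 4 → k) j) →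
      ((![γ 1, -γ 0, κ * γ 3, -(κ * γ 2)] : Fin 4 → k) i ≠
      (![γ 1, -γ 0, κ * γ 3, -(κ * γ 2)] : Fin 4 → k) m) →
      P.Lim ((z i - z j) * (z i - z m)⁻¹) 0 := by
    intro i j m hij him
    refine Place.congr (P.mul (Place.sub (l i) (l j)) (P.inv (Place.sub (l i) (l m))
      (sub_ne_zero.2 him))) ?_ (by rw [hij]; ring)
    rw [← mul_sub, ← mul_sub, mul_inv, mul_mul_mul_comm, mul_inv_cancel₀ hα0, one_mul]
  have q1 : γ 1 ≠ -γ 0 := by rwa [Ne, eq_neg_iff_add_eq_zero]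
  have a0 : P.Lim ((z 0 - z 2) * w 0) (γ 2) := by
    refine Place.congr (P.add (P.add (P.mul (W.lim 1) (ratio 0 2 1 ?_ ?_)) (W.lim 2))
      (P.mul (W.lim 3) (ratio 0 2 3 ?_ ?_))) ?_ (by ring)
    · simp [e1]
    · simpa using q1
    · simp [e1]
    · simpa [← e0] using q1
    rw [h.swap.z_zero]
    field_simp
  have b1 : P.Lim ((z 1 - z 3) * w 1) (γ 3) := by
    refine Place.congr (P.add (P.add (P.mul (W.lim 0) (ratio 1 3 0 ?_ ?_)) (W.lim 3))
      (P.mul (W.lim 2) (ratio 1 3 2 ?_ ?_))) ?_ (by ring)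
    · simp [e0]
    · simpa using q1.symm
    · simp [e0]
    · simpa [← e1] using q1.symm
    rw [h.swap.z_one]
    field_simp
    ring
  have hω2 : ω 2 = -κ * ω 0 := by
    have e := h.swap.sum_mul_lim_z W hw
    rw [← h01, ← h23] at e
    have hne : γ 2 + γ 3 ≠ 0 := by
      intro e2; apply hs; linear_combination e0 + e1 + κ * e2
    have : (γ 2 + γ 3) * (ω 2 - -κ * ω 0) = 0 := by linear_combination e - ω 0 * e0 - ω 0 * e1
    exact sub_eq_zero.1 ((mul_eq_zero.1 this).resolve_left hne)
  have hω0 : ω 0 ≠ 0 := by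
    intro h0; apply h02; rw [hω2, h0, mul_zero]
  have w0 : w 0 ≠ 0 := Place.ne_zero (hw 0) hω0
  have w1 : w 1 ≠ 0 := Place.ne_zero (hw 1) (h01 ▸ hω0)
  have A : P.Lim (z 0 - z 2) (γ 2 / ω 0) :=
    Place.congr (Place.div a0 (hw 0) hω0) (by field_simp) rfl
  have B : P.Lim (z 1 - z 3) (γ 3 / ω 0) :=
    Place.congr (Place.div b1 (hw 1) (h01 ▸ hω0)) (by field_simp) (by rw [h01])
  have hP : ω 0 - ω 2 ≠ 0 := sub_ne_zero.2 h02
  have c02 : P.Lim (w 0 - w 2)⁻¹ (ω 0 - ω 2)⁻¹ := P.inv (Place.sub (hw 0) (hw 2)) hP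
  have c03 : P.Lim (w 0 - w 3)⁻¹ (ω 0 - ω 2)⁻¹ :=
    h23 ▸ P.inv (Place.sub (hw 0) (hw 3)) (sub_ne_zero.2 h03)
  have c12 : P.Lim (w 1 - w 2)⁻¹ (ω 0 - ω 2)⁻¹ :=
    h01 ▸ P.inv (Place.sub (hw 1) (hw 2)) (sub_ne_zero.2 h12)
  have c13 : P.Lim (w 1 - w 3)⁻¹ (ω 0 - ω 2)⁻¹ :=
    Place.congr (P.inv (Place.sub (hw 1) (hw 3)) (sub_ne_zero.2 h13)) rfl (by rw [h01, h23])
  have hprod : G 1 * G 2 = G 0 * G 3 := W.prod 1 2 0 3 (by rw [e1, e0]; ring)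
  have key : G 0 * (z 0 - z 2) + G 1 * (z 1 - z 3) =
      G 0 * (G 2 * (w 0 - w 2)⁻¹ + G 3 * (w 0 - w 3)⁻¹ + G 0 * (w 0 - w 2)⁻¹ +
        G 1 * (w 1 - w 2)⁻¹) +
      G 1 * (G 2 * (w 1 - w 2)⁻¹ + G 3 * (w 1 - w 3)⁻¹ + G 0 * (w 0 - w 3)⁻¹ +
        G 1 * (w 1 - w 3)⁻¹) := by
    have flip : ∀ i j, (w j - w i)⁻¹ = -(w i - w j)⁻¹ := fun i j => by rw [← inv_neg, neg_sub]
    rw [h.z_zero, h.z_one, h.z_two, h.z_three, flip 0 1, flip 0 2, flip 0 3, flip 1 2, flip 1 3,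
      flip 2 3]
    linear_combination (w 2 - w 3)⁻¹ * hprod
  have lhs := P.add (P.mul (W.lim 0) A) (P.mul (W.lim 1) B)
  rw [key] at lhs
  have rhs := P.add
    (P.mul (W.lim 0) (P.add (P.add (P.add (P.mul (W.lim 2) c02) (P.mul (W.lim 3) c03))
      (P.mul (W.lim 0) c02)) (P.mul (W.lim 1) c12)))
    (P.mul (W.lim 1) (P.add (P.add (P.add (P.mul (W.lim 2) c12) (P.mul (W.lim 3) c13))
      (P.mul (W.lim 0) c03)) (P.mul (W.lim 1) c13)))
  have e := P.unique lhs rhs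
  have hP' : 1 + κ ≠ 0 := by
    intro h0; apply h02; rw [hω2]; linear_combination ω 0 * h0
  have hPe : ω 0 - ω 2 = ω 0 * (1 + κ) := by rw [hω2]; ring
  rw [hPe, e0, e1] at e
  have hfin : 2 * (κ * γ 2 * γ 3) = 0 := by
    field_simp at e
    have : (1 + κ) * (2 * (κ * γ 2 * γ 3)) = 0 := by
      grind
    exact (mul_eq_zero.1 this).resolve_left hP'
  have := charZero_of_real_algebra k
  exact mul_ne_zero two_ne_zero (mul_ne_zero (mul_ne_zero hκ0 (W.ne 2)) (W.ne 3)) hfin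

/-- In the rescaled limit `(γ_1, -γ_0, κ γ_3, -κ γ_2)` of `z`, coincidences can occur only across
the pairs. No coincidence would make `w / α` finite, where `α = w_0 - w_1`, one is a single
collision, and two form a matching, possibly after exchanging `2` and `3`. -/
theorem not_two_pairs_of_finite_ratio (h : IsSystem G z w) (W : Weights P G γ)
    (hw : ∀ n, P.Lim (w n) (ω n)) (h01 : ω 0 = ω 1) (h23 : ω 2 = ω 3) (h02 : ω 0 ≠ ω 2)
    (hs : γ 0 + γ 1 ≠ 0) (hs' : γ 2 + γ 3 ≠ 0)
    (hκ : P.Lim ((w 0 - w 1) * (w 2 - w 3)⁻¹) κ) : False := by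
  by_cases hκ0 : κ = 0
  · subst hκ0
    exact not_two_pairs_of_ratio_zero h W hw h01 h23 h02 hκ hs
  have hα0 : w 0 - w 1 ≠ 0 := h.w_sub_ne (by decide)
  have hα : P.Lim (w 0 - w 1) 0 := Place.congr (Place.sub (hw 0) (hw 1)) rfl (by rw [h01, sub_self])
  have l := lim_scaled_of_two_pairs h W hw h01 h23 h02 hκ
  have hsys := (h.scale hα0).swap
  have h03 : ω 0 ≠ ω 3 := h23 ▸ h02
  have q01 : γ 1 ≠ -γ 0 := by intro e; apply hs; linear_combination e
  have q23 : κ * γ 3 ≠ -(κ * γ 2) := by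
    intro e; apply hs'
    have : κ * (γ 2 + γ 3) = 0 := by linear_combination e
    exact (mul_eq_zero.1 this).resolve_left hκ0
  have swapped : γ 1 = -(κ * γ 2) → -γ 0 = κ * γ 3 → False := fun e1 e0 => by
    refine not_two_pairs_matching (h.perm (Equiv.swap 2 3)) (W.perm (Equiv.swap 2 3))
        (ω := ω ∘ Equiv.swap 2 3) (κ := -κ) (fun n => hw _) h01 h23.symm h03 hs ?_
        (neg_ne_zero.2 hκ0) ?_ ?_
    · refine Place.congr (Place.neg hκ) ?_ rfl
      change _ = (w 0 - w 1) * (w 3 - w 2)⁻¹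
      rw [← neg_sub (w 2) (w 3), inv_neg]; ring
    · change γ 1 = -κ * γ 2
      linear_combination e1
    · change γ 0 = -κ * γ 3
      linear_combination -e0
  by_cases c02 : γ 1 = κ * γ 3
  · by_cases c13 : -γ 0 = -(κ * γ 2)
    · exact not_two_pairs_matching h W hw h01 h23 h02 hs hκ hκ0 c02 (neg_injective c13)
    · exact not_one_collision hsys W l 0 2 1 3 (by decide) c02 q01 (c02 ▸ q23) c13
  · by_cases c13 : -γ 0 = -(κ * γ 2)
    · exact not_one_collision hsys W l 1 3 0 2 (by decide) c13 q01.symm (c13 ▸ q23.symm) c02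
    · by_cases c03 : γ 1 = -(κ * γ 2)
      · by_cases c12 : -γ 0 = κ * γ 3
        · exact swapped c03 c12
        · exact not_one_collision hsys W l 0 3 1 2 (by decide) c03 q01 c02 c12
      · by_cases c12 : -γ 0 = κ * γ 3
        · exact not_one_collision hsys W l 1 2 0 3 (by decide) c12 q01.symm c13 c03
        · refine not_finite_of_scaled hα0 hα hw h02 (hsys.finite_z_of_injective W l ?_)
          intro i j
          fin_cases i <;> fin_cases j <;> simp <;> grind

theorem not_two_pairs_aux (h : IsSystem G z w) (W : Weights P G γ)
    (hw : ∀ n, P.Lim (w n) (ω n)) (h01 : ω 0 = ω 1) (h23 : ω 2 = ω 3) (h02 : ω 0 ≠ ω 2) :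
    False := by
  let σ : Equiv.Perm (Fin 4) := Equiv.swap 0 2 * Equiv.swap 1 3
  by_cases hs : γ 0 + γ 1 = 0
  · exact not_opposite_pair h W hw h01 h23 h02 hs
  by_cases hs' : γ 2 + γ 3 = 0
  · exact not_opposite_pair (h.perm σ) (W.perm σ) (ω := ω ∘ σ) (fun n => hw _) h23 h01 h02.symm hs'
  rcases P.finite_or ((w 0 - w 1) * (w 2 - w 3)⁻¹) with ⟨κ, hκ⟩ | hκ
  · exact not_two_pairs_of_finite_ratio h W hw h01 h23 h02 hs hs' hκ
  · refine not_two_pairs_of_finite_ratio (h.perm σ) (W.perm σ) (ω := ω ∘ σ) (κ := 0)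
      (fun n => hw _) h23 h01 h02.symm hs' hs ?_
    rw [mul_inv, inv_inv, mul_comm] at hκ
    exact hκ

/-- The limit of `w` is never a configuration in which two pairs of points collide. -/
theorem not_two_pairs (h : IsSystem G z w) (W : Weights P G γ)
    (hw : ∀ n, P.Lim (w n) (ω n)) (i j l m : Fin 4) (hij : i ≠ j) (hlm : l ≠ m) (e : ω i = ω j)
    (e' : ω l = ω m) (hil : ω i ≠ ω l) : False := by
  obtain ⟨σ, rfl, rfl, rfl, rfl⟩ := exists_perm (i := i) (j := j) (l := l) (m := m) hij
    (by rintro rfl; exact hil rfl) (by rintro rfl; exact hil e'.symm)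
    (by rintro rfl; exact hil e) (by rintro rfl; exact hil (e.trans e'.symm)) hlm
  exact not_two_pairs_aux (h.perm σ) (W.perm σ) (fun n => hw (σ n)) e e' hil

/-- `A` excludes partitions of type `2+1+1` and `C` those of type `2+2`. The case of four equal
values is allowed. -/
theorem exists_three_equal {α : Type*} (ω : Fin 4 → α) (N : ¬ Function.Injective ω)
    (A : ∀ i j l m, i ≠ j → ω i = ω j → ω i ≠ ω l → ω i ≠ ω m → ω l = ω m)
    (C : ∀ i j l m, i ≠ j → l ≠ m → ω i = ω j → ω l = ω m → ω i = ω l) :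
    ∃ m, ∀ i j, i ≠ m → j ≠ m → ω i = ω j := by
  have a01 := A 0 1 2 3 (by decide)
  have a02 := A 0 2 1 3 (by decide)
  have a03 := A 0 3 1 2 (by decide)
  have a12 := A 1 2 0 3 (by decide)
  have a13 := A 1 3 0 2 (by decide)
  have a23 := A 2 3 0 1 (by decide)
  have c1 := C 0 1 2 3 (by decide) (by decide)
  have c2 := C 0 2 1 3 (by decide) (by decide)
  have c3 := C 0 3 1 2 (by decide) (by decide)
  have n : ω 0 = ω 1 ∨ ω 0 = ω 2 ∨ ω 0 = ω 3 ∨ ω 1 = ω 2 ∨ ω 1 = ω 3 ∨ ω 2 = ω 3 := by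
    clear * - N
    by_contra hn
    push Not at hn
    obtain ⟨h1, h2, h3, h4, h5, h6⟩ := hn
    refine N fun i j => ?_
    fin_cases i <;> fin_cases j <;> simp <;> grind
  have hd : (ω 1 = ω 2 ∧ ω 1 = ω 3) ∨ (ω 0 = ω 2 ∧ ω 0 = ω 3) ∨ (ω 0 = ω 1 ∧ ω 0 = ω 3) ∨
      (ω 0 = ω 1 ∧ ω 0 = ω 2) := by
    clear A C N
    generalize ω 0 = a at *
    generalize ω 1 = b at *
    generalize ω 2 = c at *
    generalize ω 3 = d at *
    grind
  clear * - hd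
  rcases hd with ⟨e, e'⟩ | ⟨e, e'⟩ | ⟨e, e'⟩ | ⟨e, e'⟩
  · exact ⟨0, fun i j hi hj => by fin_cases i <;> fin_cases j <;> simp_all⟩
  · exact ⟨1, fun i j hi hj => by fin_cases i <;> fin_cases j <;> simp_all⟩
  · exact ⟨2, fun i j hi hj => by fin_cases i <;> fin_cases j <;> simp_all⟩
  · exact ⟨3, fun i j hi hj => by fin_cases i <;> fin_cases j <;> simp_all⟩

/-- If `w` has a limit and `z` is not finite then three points collide in the limit of `w`. -/
theorem exists_triple_collision (h : IsSystem G z w) (W : Weights P G γ)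
    (hw : ∀ n, P.Lim (w n) (ω n)) (hz : ¬ ∀ n, ∃ c, P.Lim (z n) c) :
    ∃ m, ∀ i j, i ≠ m → j ≠ m → ω i = ω j := by
  refine exists_three_equal ω (fun hi => hz (h.finite_z_of_injective W hw hi)) ?_ ?_
  · intro i j l m hij e hil him
    by_contra hlm
    exact not_one_collision h W hw i j l m hij e hil him hlm
  · intro i j l m hij hlm e e'
    by_contra hil
    exact not_two_pairs h W hw i j l m hij hlm e e' hil

end FourVortex

/-! ### Triple collisions and finiteness of the products at every place -/

namespace FourVortex

variable {K k : Type*} [Field K] [Field k] [Algebra ℝ K] [Algebra ℝ k] {P : Place K k}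
  {G : Fin 4 → K} {γ : Fin 4 → k} {z w : Fin 4 → K} {ω ζ : Fin 4 → k} {ρ : k}

/-- A triple collision in which two of the three points are much closer is impossible. -/
theorem not_nested_collision (h : IsSystem G z w) (W : Weights P G γ)
    (hw : ∀ n, P.Lim (w n) (ω n)) (h01 : ω 0 = ω 1) (h02 : ω 0 = ω 2) (h03 : ω 0 ≠ ω 3)
    (hr : P.Lim ((w 0 - w 1) * (w 0 - w 2)⁻¹) 0) : False := by
  have h13 : ω 1 ≠ ω 3 := h01 ▸ h03
  have h23 : ω 2 ≠ ω 3 := h02 ▸ h03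
  have hα0 : w 0 - w 1 ≠ 0 := h.w_sub_ne (by decide)
  have n02 : w 0 - w 2 ≠ 0 := h.w_sub_ne (by decide)
  have n12 : w 1 - w 2 ≠ 0 := h.w_sub_ne (by decide)
  have hα : P.Lim (w 0 - w 1) 0 := Place.congr (Place.sub (hw 0) (hw 1)) rfl (by rw [h01, sub_self])
  have h' := h.scale hα0
  have scaled : ∀ {i j c}, P.Lim ((w 0 - w 1) * (w i - w j)⁻¹) c →
      P.Lim ((w 0 - w 1)⁻¹ * w i - (w 0 - w 1)⁻¹ * w j)⁻¹ c := by
    intro i j c hc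
    rwa [← mul_sub, mul_inv, inv_inv]
  have rev : ∀ {i j}, P.Lim ((w 0 - w 1) * (w i - w j)⁻¹) 0 →
      P.Lim ((w 0 - w 1) * (w j - w i)⁻¹) 0 := by
    intro i j hc
    refine Place.congr (Place.neg hc) ?_ neg_zero
    rw [← neg_sub (w j) (w i), inv_neg]; ring
  have far : ∀ i j, ω i ≠ ω j → P.Lim ((w 0 - w 1) * (w i - w j)⁻¹) 0 := fun i j hij =>
    Place.congr (P.mul hα (P.inv (Place.sub (hw i) (hw j)) (sub_ne_zero.2 hij))) rfl (zero_mul _)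
  have hr' : P.Lim ((w 0 - w 1) * (w 1 - w 2)⁻¹) 0 := by
    refine Place.congr (Place.div hr (Place.sub Place.one hr) (by norm_num)) ?_ (by norm_num)
    have : 1 - (w 0 - w 1) * (w 0 - w 2)⁻¹ = (w 1 - w 2) * (w 0 - w 2)⁻¹ := by
      field_simp
      ring
    rw [this]
    field_simp
  have e01 : P.Lim ((w 0 - w 1) * (w 0 - w 1)⁻¹) 1 :=
    Place.congr Place.one (mul_inv_cancel₀ hα0).symm rfl
  have e10 : P.Lim ((w 0 - w 1) * (w 1 - w 0)⁻¹) (-1) := by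
    refine Place.congr (Place.neg e01) ?_ rfl
    rw [← neg_sub (w 0) (w 1), inv_neg]; ring
  have self : ∀ i, P.Lim ((w 0 - w 1) * (w i - w i)⁻¹) 0 := fun i => by simpa using Place.zero
  have l : ∀ n, P.Lim ((w 0 - w 1) * z n) (![γ 1, -γ 0, 0, 0] n) := by
    intro n
    fin_cases n
    · refine Place.congr (h'.lim_z_of_inv W 0 ![0, 1, 0, 0] fun j => scaled ?_) rfl
        (by simp [Fin.sum_univ_four])
      fin_cases j
      exacts [self 0, e01, hr, far _ _ h03]
    · refine Place.congr (h'.lim_z_of_inv W 1 ![-1, 0, 0, 0] fun j => scaled ?_) rfl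
        (by simp [Fin.sum_univ_four])
      fin_cases j
      exacts [e10, self 1, hr', far _ _ h13]
    · refine Place.congr (h'.lim_z_of_inv W 2 ![0, 0, 0, 0] fun j => scaled ?_) rfl
        (by simp [Fin.sum_univ_four])
      fin_cases j
      exacts [rev hr, rev hr', self 2, far _ _ h23]
    · refine Place.congr (h'.lim_z_of_inv W 3 ![0, 0, 0, 0] fun j => scaled ?_) rfl
        (by simp [Fin.sum_univ_four])
      fin_cases j
      exacts [far _ _ h03.symm, far _ _ h13.symm, far _ _ h23.symm, self 3]
  -- The limit `(γ_1, -γ_0, 0, 0)` is a two-pair or a one-pair collision of the exchanged system.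
  by_cases hs : γ 1 = -γ 0
  · exact not_two_pairs h'.swap W l 0 1 2 3 (by decide) (by decide) hs rfl (W.ne 1)
  · exact not_one_collision h'.swap W l 2 3 0 1 (by decide) rfl (W.ne 1).symm
      (neg_ne_zero.2 (W.ne 0)).symm hs

/-- The case of a triple collision of `w` at a single rate that is a nonzero rigid translation of
the three colliding vortices. -/
theorem not_translating_triple (h : IsSystem G z w) (W : Weights P G γ)
    (hw : ∀ n, P.Lim (w n) (ω n)) (h01 : ω 0 = ω 1) (h02 : ω 0 = ω 2) (h03 : ω 0 ≠ ω 3)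
    (hρ : P.Lim ((w 0 - w 1) * (w 0 - w 2)⁻¹) ρ) (hs : γ 0 + γ 1 + γ 2 = 0) {c : k} (hc : c ≠ 0)
    (l0 : P.Lim ((w 0 - w 2) * z 0) c) (l1 : P.Lim ((w 0 - w 2) * z 1) c)
    (l2 : P.Lim ((w 0 - w 2) * z 2) c) (l3 : P.Lim ((w 0 - w 2) * z 3) 0) : False := by
  have hδ0 : w 0 - w 2 ≠ 0 := h.w_sub_ne (by decide)
  have n01 := h.z_sub_ne (i := 0) (j := 1) (by decide)
  have n02 := h.z_sub_ne (i := 0) (j := 2) (by decide)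
  have n12 := h.z_sub_ne (i := 1) (j := 2) (by decide)
  have n13 := h.z_sub_ne (i := 1) (j := 3) (by decide)
  have n23 := h.z_sub_ne (i := 2) (j := 3) (by decide)
  have n30 : ω 3 - ω 0 ≠ 0 := sub_ne_zero.2 h03.symm
  have lz3 : P.Lim (z 3) 0 := by
    rw [h.z_three]
    refine Place.congr (P.add (P.add
      (P.mul (W.lim 0) (P.inv (Place.sub (hw 3) (hw 0)) n30))
      (P.mul (W.lim 1) (P.inv (Place.sub (hw 3) (hw 1)) (h01 ▸ n30))))
      (P.mul (W.lim 2) (P.inv (Place.sub (hw 3) (hw 2)) (h02 ▸ n30)))) rfl ?_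
    rw [← h01, ← h02]
    linear_combination (ω 3 - ω 0)⁻¹ * hs
  have a1 : P.Lim ((z 1 - z 0) * (w 1 - w 0)) 0 := by
    refine Place.congr (Place.neg (P.mul (Place.sub l1 l0) hρ)) ?_ (by ring)
    field_simp
    ring
  have a2 : P.Lim ((z 2 - z 0) * (w 2 - w 0)) 0 :=
    Place.congr (Place.neg (Place.sub l2 l0)) (by ring) (by ring)
  have b1 : P.Lim ((z 1 - z 0) * (z 1 - z 3)⁻¹) 0 := by
    refine Place.congr (Place.div (Place.sub l1 l0) (Place.sub l1 l3) (by simpa)) ?_ (by simp)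
    rw [← mul_sub, ← mul_sub, mul_div_mul_left _ _ hδ0, div_eq_mul_inv]
  have b2 : P.Lim ((z 2 - z 0) * (z 2 - z 3)⁻¹) 0 := by
    refine Place.congr (Place.div (Place.sub l2 l0) (Place.sub l2 l3) (by simpa)) ?_ (by simp)
    rw [← mul_sub, ← mul_sub, mul_div_mul_left _ _ hδ0, div_eq_mul_inv]
  have lhs := Place.sub (P.add (P.add (Place.neg (P.mul (hw 0) (P.mul (W.lim 3) lz3)))
    (P.mul (W.lim 1) a1)) (P.mul (W.lim 2) a2))
    (P.mul (W.lim 3) (P.add (P.mul (W.lim 1) b1) (P.mul (W.lim 2) b2)))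
  have rhs := P.add (P.add (P.mul (W.lim 0) (W.lim 1)) (P.mul (W.lim 0) (W.lim 2)))
    (P.mul (W.lim 1) (W.lim 2))
  refine W.momentum_ne 0 1 2 hs (P.unique rhs (Place.congr lhs ?_ (by ring)))
  have hG := W.triple 0 1 2 hs
  have hz := h.sum_mul_z
  rw [Fin.sum_univ_four] at hz
  -- The virial identity of the triple, with `z` measured from `z_0`. Measuring `w` from `w_0` as
  -- well costs only `w_0 G_3 z_3 → 0`, so every term except the angular momentum of the triple
  -- tends to `0`.
  have key : G 1 * ((z 1 - z 0) * w 1) + G 2 * ((z 2 - z 0) * w 2) =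
      G 0 * G 1 + G 0 * G 2 + G 1 * G 2 +
      G 3 * (G 1 * ((z 1 - z 0) * (z 1 - z 3)⁻¹) + G 2 * ((z 2 - z 0) * (z 2 - z 3)⁻¹)) := by
    have n10 : z 1 - z 0 ≠ 0 := h.z_sub_ne (by decide)
    have n20 : z 2 - z 0 ≠ 0 := h.z_sub_ne (by decide)
    rw [h.swap.z_one, h.swap.z_two, ← neg_sub (z 1) (z 2), inv_neg]
    field_simp
    ring
  linear_combination key + w 0 * z 0 * hG - w 0 * hz

/-- The case of a triple collision of `w` in which the three colliding vortices are in
equilibrium. -/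
theorem not_equilibrium_triple (h : IsSystem G z w) (W : Weights P G γ)
    (hw : ∀ n, P.Lim (w n) (ω n)) (h01 : ω 0 = ω 1) (h02 : ω 0 = ω 2) (h03 : ω 0 ≠ ω 3)
    (hρ : P.Lim ((w 0 - w 1) * (w 0 - w 2)⁻¹) ρ) (hρ0 : ρ ≠ 0) (hρ1 : 1 - ρ ≠ 0)
    (e0 : γ 1 / ρ + γ 2 = 0) (e1 : -γ 0 / ρ + γ 2 / (1 - ρ) = 0)
    (hz : ¬ ∀ n, ∃ c, P.Lim (z n) c) : False := by
  have h13 : ω 1 ≠ ω 3 := h01 ▸ h03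
  have h23 : ω 2 ≠ ω 3 := h02 ▸ h03
  have n01 : w 0 - w 1 ≠ 0 := h.w_sub_ne (by decide)
  have n02 : w 0 - w 2 ≠ 0 := h.w_sub_ne (by decide)
  have n12 : w 1 - w 2 ≠ 0 := h.w_sub_ne (by decide)
  have g0 := W.ne 0
  have g1 := W.ne 1
  have g2 := W.ne 2
  have q1 : γ 1 = -(ρ * γ 2) := by
    field_simp at e0; linear_combination e0
  have q0 : γ 0 * (1 - ρ) = ρ * γ 2 := by
    field_simp at e1; linear_combination -e1
  have hL : γ 0 * γ 1 + γ 0 * γ 2 + γ 1 * γ 2 = 0 := by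
    rw [q1]; linear_combination γ 2 * q0
  have hGL := W.momentum 0 1 2 hL
  -- `E_n` is the contribution of the triple alone to `z_n`; that of vortex `3` stays finite.
  obtain ⟨E0, hE0⟩ : ∃ E, E = G 1 * (w 0 - w 1)⁻¹ + G 2 * (w 0 - w 2)⁻¹ := ⟨_, rfl⟩
  obtain ⟨E1, hE1⟩ : ∃ E, E = -(G 0 * (w 0 - w 1)⁻¹) + G 2 * (w 1 - w 2)⁻¹ := ⟨_, rfl⟩
  obtain ⟨E2, hE2⟩ : ∃ E, E = -(G 0 * (w 0 - w 2)⁻¹) - G 1 * (w 1 - w 2)⁻¹ := ⟨_, rfl⟩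
  have c0 := P.mul (W.lim 3) (P.inv (Place.sub (hw 0) (hw 3)) (sub_ne_zero.2 h03))
  have c1 := P.mul (W.lim 3) (P.inv (Place.sub (hw 1) (hw 3)) (sub_ne_zero.2 h13))
  have c2 := P.mul (W.lim 3) (P.inv (Place.sub (hw 2) (hw 3)) (sub_ne_zero.2 h23))
  have c3 := P.add (P.add (P.mul (W.lim 0) (P.inv (Place.sub (hw 3) (hw 0))
    (sub_ne_zero.2 h03.symm))) (P.mul (W.lim 1) (P.inv (Place.sub (hw 3) (hw 1))
    (sub_ne_zero.2 h13.symm)))) (P.mul (W.lim 2) (P.inv (Place.sub (hw 3) (hw 2))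
    (sub_ne_zero.2 h23.symm)))
  have z0 : z 0 = E0 + G 3 * (w 0 - w 3)⁻¹ := by rw [h.z_zero, hE0]
  have z1 : z 1 = E1 + G 3 * (w 1 - w 3)⁻¹ := by
    rw [h.z_one, hE1, ← neg_sub (w 0) (w 1), inv_neg]; ring
  have z2 : z 2 = E2 + G 3 * (w 2 - w 3)⁻¹ := by
    rw [h.z_two, hE2, ← neg_sub (w 0) (w 2), ← neg_sub (w 1) (w 2), inv_neg, inv_neg]; ring
  have z3 := h.z_three
  have G0 := W.G_ne 0
  have G2 := W.G_ne 2
  -- Both linear relations, `∑ G_n E_n = 0` and `∑ G_n (w_0 - w_n) E_n = 0`, are exact, the second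
  -- because the triple has zero angular momentum. They make `E_0` and `E_2` multiples of `E_1` with
  -- finite coefficients.
  have r2 : E2 = -(G 1 / G 2 * ((w 0 - w 1) * (w 0 - w 2)⁻¹)) * E1 := by
    have : G 1 * (w 0 - w 1) * E1 + G 2 * (w 0 - w 2) * E2 = 0 := by
      rw [hE1, hE2]
      field_simp
      linear_combination -(w 1 - w 2) * hGL
    field_simp
    linear_combination this
  have r0 : E0 = -(G 1 / G 0 * (1 - (w 0 - w 1) * (w 0 - w 2)⁻¹)) * E1 := by
    have : G 0 * E0 + G 1 * E1 + G 2 * E2 = 0 := by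
      rw [hE0, hE1, hE2]; ring
    rw [r2] at this
    field_simp at this ⊢
    linear_combination this
  have s2 := Place.neg (P.mul (Place.div (W.lim 1) (W.lim 2) g2) hρ)
  have s0 := Place.neg (P.mul (Place.div (W.lim 1) (W.lim 0) g0) (Place.sub Place.one hρ))
  rcases P.finite_or E1 with ⟨e, he⟩ | hinf
  · refine hz fun n => ?_
    fin_cases n
    · exact ⟨_, Place.congr (P.add (P.mul s0 he) c0) (by rw [← r0]; exact z0.symm) rfl⟩
    · exact ⟨_, Place.congr (P.add he c1) z1.symm rfl⟩
    · exact ⟨_, Place.congr (P.add (P.mul s2 he) c2) (by rw [← r2]; exact z2.symm) rfl⟩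
    · exact ⟨_, Place.congr c3 z3.symm rfl⟩
  · have hE : E1 ≠ 0 := by
      rintro rfl
      refine hz fun n => ?_
      rw [mul_zero] at r0 r2
      rw [r0, zero_add] at z0
      rw [r2, zero_add] at z2
      rw [zero_add] at z1
      fin_cases n
      exacts [⟨_, Place.congr c0 z0.symm rfl⟩, ⟨_, Place.congr c1 z1.symm rfl⟩,
        ⟨_, Place.congr c2 z2.symm rfl⟩, ⟨_, Place.congr c3 z3.symm rfl⟩]
    have hE' := inv_ne_zero hE
    have l : ∀ n, P.Lim (E1⁻¹ * z n)
        (![-(γ 1 / γ 0 * (1 - ρ)), 1, -(γ 1 / γ 2 * ρ), 0] n) := by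
      intro n
      fin_cases n
      · refine Place.congr (P.add s0 (P.mul hinf c0)) ?_ (by simp)
        change _ = E1⁻¹ * z 0
        rw [z0, r0]; field_simp
      · refine Place.congr (P.add Place.one (P.mul hinf c1)) ?_ (by simp)
        change _ = E1⁻¹ * z 1
        rw [z1]; field_simp
      · refine Place.congr (P.add s2 (P.mul hinf c2)) ?_ (by simp)
        change _ = E1⁻¹ * z 2
        rw [z2, r2]; field_simp
      · refine Place.congr (P.mul hinf c3) ?_ (by simp)
        change _ = E1⁻¹ * z 3
        rw [z3]
    -- Dividing by the infinite `E_1` makes `z` finite and `w` infinite, so three entries of the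
    -- limit agree. Its first three entries are nonzero and the last is `0`, so the first three all
    -- equal `1`.
    obtain ⟨m, hm⟩ := exists_triple_collision (h.scale hE').swap W l
      (not_finite_of_scaled hE' hinf hw h03)
    have v0 : -(γ 1 / γ 0 * (1 - ρ)) ≠ 0 := neg_ne_zero.2 (mul_ne_zero (div_ne_zero g1 g0) hρ1)
    have v2 : -(γ 1 / γ 2 * ρ) ≠ 0 := neg_ne_zero.2 (mul_ne_zero (div_ne_zero g1 g2) hρ0)
    have hm3 : m = 3 := by
      by_contra hm3
      by_cases hm0 : m = 0
      · exact one_ne_zero (hm 1 3 (by subst hm0; decide) (Ne.symm hm3))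
      · exact v0 (hm 0 3 (Ne.symm hm0) (Ne.symm hm3))
    subst hm3
    have t0 : -(γ 1 / γ 0 * (1 - ρ)) = 1 := hm 0 1 (by decide) (by decide)
    have t2 : -(γ 1 / γ 2 * ρ) = 1 := hm 2 1 (by decide) (by decide)
    have u2 : (γ 1 - γ 2) * (γ 1 + γ 2) = 0 := by
      field_simp at t2
      linear_combination γ 1 * q1 + γ 2 * t2
    have u0 : (γ 1 - γ 0) * (γ 1 + γ 0) = 0 := by
      field_simp at t0
      linear_combination γ 1 * q0 + γ 1 * q1 + γ 0 * t0
    have hchar := charZero_of_real_algebra k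
    have sq : ∀ {x : k}, x ≠ 0 → ∀ n : ℕ, (n : k) ≠ 0 → (n : k) * x ^ 2 ≠ 0 := fun hx n hn =>
      mul_ne_zero hn (pow_ne_zero 2 hx)
    -- With `γ_0` and `γ_2` equal to `±γ_1`, the angular momentum of the triple is `3 γ_1²` or
    -- `-γ_1²`, never `0`.
    rcases mul_eq_zero.1 u2 with u2 | u2 <;> rcases mul_eq_zero.1 u0 with u0 | u0
    · refine sq g1 3 (by norm_num) ?_
      push_cast
      have x2 : γ 2 = γ 1 := by linear_combination -u2
      have x0 : γ 0 = γ 1 := by linear_combination -u0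
      rw [x2, x0] at hL; linear_combination hL
    · refine sq g1 1 (by norm_num) ?_
      push_cast
      have x2 : γ 2 = γ 1 := by linear_combination -u2
      have x0 : γ 0 = -γ 1 := by linear_combination u0
      rw [x2, x0] at hL; linear_combination -hL
    · refine sq g1 1 (by norm_num) ?_
      push_cast
      have x2 : γ 2 = -γ 1 := by linear_combination u2
      have x0 : γ 0 = γ 1 := by linear_combination -u0
      rw [x2, x0] at hL; linear_combination -hL
    · refine sq g1 1 (by norm_num) ?_
      push_cast
      have x2 : γ 2 = -γ 1 := by linear_combination u2
      have x0 : γ 0 = -γ 1 := by linear_combination u0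
      rw [x2, x0] at hL; linear_combination -hL

/-- A ratio `ρ` equal to `0`, `1` or infinity is a nested collision after relabelling. Otherwise,
scaled by `w_0 - w_2`, `z` tends to some `(x, y, v, 0)` with three equal entries, and the vanishing
moment forces `x = y = v`. The common value `0` is an equilibrium of the triple; a nonzero one is a
translation, and then `γ_0 + γ_1 + γ_2 = 0`. -/
theorem not_triple_collision_aux (h : IsSystem G z w) (W : Weights P G γ)
    (hw : ∀ n, P.Lim (w n) (ω n)) (h01 : ω 0 = ω 1) (h02 : ω 0 = ω 2) (h03 : ω 0 ≠ ω 3)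
    (hz : ¬ ∀ n, ∃ c, P.Lim (z n) c) : False := by
  have n01 : w 0 - w 1 ≠ 0 := h.w_sub_ne (by decide)
  have n02 : w 0 - w 2 ≠ 0 := h.w_sub_ne (by decide)
  have n12 : w 1 - w 2 ≠ 0 := h.w_sub_ne (by decide)
  have h13 : ω 1 ≠ ω 3 := h01 ▸ h03
  have h23 : ω 2 ≠ ω 3 := h02 ▸ h03
  rcases P.finite_or ((w 0 - w 1) * (w 0 - w 2)⁻¹) with ⟨ρ, hρ⟩ | hinf
  swap
  · refine not_nested_collision (h.perm (Equiv.swap 1 2)) (W.perm (Equiv.swap 1 2))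
      (ω := ω ∘ Equiv.swap 1 2) (fun n => hw _) h02 h01 h03 ?_
    rw [mul_inv, inv_inv, mul_comm] at hinf
    exact hinf
  by_cases hρ0 : ρ = 0
  · subst hρ0; exact not_nested_collision h W hw h01 h02 h03 hρ
  by_cases hρ1 : 1 - ρ = 0
  · refine not_nested_collision (h.perm (Equiv.swap 0 2)) (W.perm (Equiv.swap 0 2))
      (ω := ω ∘ Equiv.swap 0 2) (fun n => hw _) (h02.symm.trans h01) h02.symm h23 ?_
    refine Place.congr (Place.sub Place.one hρ) ?_ hρ1
    change _ = (w 2 - w 1) * (w 2 - w 0)⁻¹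
    have n20 : w 2 - w 0 ≠ 0 := h.w_sub_ne (by decide)
    rw [← neg_sub (w 2) (w 0), inv_neg]
    field_simp
    ring
  have hδ : P.Lim (w 0 - w 2) 0 := Place.congr (Place.sub (hw 0) (hw 2)) rfl (by rw [h02, sub_self])
  have h' := h.scale n02
  have scaled : ∀ {i j c}, P.Lim ((w 0 - w 2) * (w i - w j)⁻¹) c →
      P.Lim ((w 0 - w 2)⁻¹ * w i - (w 0 - w 2)⁻¹ * w j)⁻¹ c := by
    intro i j c hc
    rwa [← mul_sub, mul_inv, inv_inv]
  have rev : ∀ {i j c}, P.Lim ((w 0 - w 2) * (w i - w j)⁻¹) c →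
      P.Lim ((w 0 - w 2) * (w j - w i)⁻¹) (-c) := by
    intro i j c hc
    refine Place.congr (Place.neg hc) ?_ rfl
    rw [← neg_sub (w j) (w i), inv_neg]; ring
  have far : ∀ i j, ω i ≠ ω j → P.Lim ((w 0 - w 2) * (w i - w j)⁻¹) 0 := fun i j hij =>
    Place.congr (P.mul hδ (P.inv (Place.sub (hw i) (hw j)) (sub_ne_zero.2 hij))) rfl (zero_mul _)
  have d01 : P.Lim ((w 0 - w 2) * (w 0 - w 1)⁻¹) ρ⁻¹ :=
    Place.congr (P.inv hρ hρ0) (by rw [mul_inv, inv_inv, mul_comm]) rfl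
  have d02 : P.Lim ((w 0 - w 2) * (w 0 - w 2)⁻¹) 1 :=
    Place.congr Place.one (mul_inv_cancel₀ n02).symm rfl
  have d12 : P.Lim ((w 0 - w 2) * (w 1 - w 2)⁻¹) (1 - ρ)⁻¹ := by
    refine Place.congr (P.inv (Place.sub Place.one hρ) hρ1) ?_ rfl
    have : 1 - (w 0 - w 1) * (w 0 - w 2)⁻¹ = (w 1 - w 2) * (w 0 - w 2)⁻¹ := by
      field_simp
      ring
    rw [this, mul_inv, inv_inv, mul_comm]
  have self : ∀ i, P.Lim ((w 0 - w 2) * (w i - w i)⁻¹) 0 := fun i => by simpa using Place.zero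
  have l : ∀ n, P.Lim ((w 0 - w 2) * z n)
      (![γ 1 / ρ + γ 2, -γ 0 / ρ + γ 2 / (1 - ρ), -γ 0 - γ 1 / (1 - ρ), 0] n) := by
    intro n
    fin_cases n
    · refine Place.congr (h'.lim_z_of_inv W 0 ![0, ρ⁻¹, 1, 0] fun j => scaled ?_) rfl
        (by simp [Fin.sum_univ_four, div_eq_mul_inv])
      fin_cases j
      exacts [self 0, d01, d02, far _ _ h03]
    · refine Place.congr (h'.lim_z_of_inv W 1 ![-ρ⁻¹, 0, (1 - ρ)⁻¹, 0] fun j => scaled ?_) rfl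
        (by simp [Fin.sum_univ_four, div_eq_mul_inv])
      fin_cases j
      exacts [rev d01, self 1, d12, far _ _ h13]
    · refine Place.congr (h'.lim_z_of_inv W 2 ![-1, -(1 - ρ)⁻¹, 0, 0] fun j => scaled ?_) rfl
        (by simp [Fin.sum_univ_four, div_eq_mul_inv]; ring)
      fin_cases j
      exacts [rev d02, rev d12, self 2, far _ _ h23]
    · refine Place.congr (h'.lim_z_of_inv W 3 ![0, 0, 0, 0] fun j => scaled ?_) rfl
        (by simp [Fin.sum_univ_four])
      fin_cases j
      exacts [far _ _ h03.symm, far _ _ h13.symm, far _ _ h23.symm, self 3]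
  obtain ⟨m, hm⟩ := exists_triple_collision h'.swap W l (not_finite_of_scaled n02 hδ hw h03)
  have hsum := h'.sum_mul_lim_z W l
  have l0 : P.Lim ((w 0 - w 2) * z 0) (γ 1 / ρ + γ 2) := l 0
  have l1 : P.Lim ((w 0 - w 2) * z 1) (-γ 0 / ρ + γ 2 / (1 - ρ)) := l 1
  have l2 : P.Lim ((w 0 - w 2) * z 2) (-γ 0 - γ 1 / (1 - ρ)) := l 2
  have l3 : P.Lim ((w 0 - w 2) * z 3) 0 := l 3
  have hsum' : γ 0 * (γ 1 / ρ + γ 2) + γ 1 * (-γ 0 / ρ + γ 2 / (1 - ρ)) +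
      γ 2 * (-γ 0 - γ 1 / (1 - ρ)) + γ 3 * 0 = 0 := hsum
  have hm01 : m ≠ 0 → m ≠ 1 → γ 1 / ρ + γ 2 = -γ 0 / ρ + γ 2 / (1 - ρ) :=
    fun a b => hm 0 1 a.symm b.symm
  have hm02 : m ≠ 0 → m ≠ 2 → γ 1 / ρ + γ 2 = -γ 0 - γ 1 / (1 - ρ) :=
    fun a b => hm 0 2 a.symm b.symm
  have hm03 : m ≠ 0 → m ≠ 3 → γ 1 / ρ + γ 2 = 0 := fun a b => hm 0 3 a.symm b.symm
  have hm13 : m ≠ 1 → m ≠ 3 → -γ 0 / ρ + γ 2 / (1 - ρ) = 0 := fun a b => hm 1 3 a.symm b.symm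
  have hm23 : m ≠ 2 → m ≠ 3 → -γ 0 - γ 1 / (1 - ρ) = 0 := fun a b => hm 2 3 a.symm b.symm
  have eqm := not_equilibrium_triple h W hw h01 h02 h03 hρ hρ0 hρ1
  have tr := fun hs c hc => not_translating_triple h W hw h01 h02 h03 hρ hs (c := c) hc
  clear hsum hm l
  generalize γ 1 / ρ + γ 2 = x at *
  generalize -γ 0 / ρ + γ 2 / (1 - ρ) = y at *
  generalize -γ 0 - γ 1 / (1 - ρ) = v at *
  have g0 := W.ne 0
  have g1 := W.ne 1
  have g2 := W.ne 2
  have hxy : x = y ∧ x = v := by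
    fin_cases m
    · have hy : y = 0 := hm13 (by decide) (by decide)
      have hv : v = 0 := hm23 (by decide) (by decide)
      rw [hy, hv] at hsum'
      have : x = 0 := by simpa [g0] using hsum'
      exact ⟨this.trans hy.symm, this.trans hv.symm⟩
    · have hx : x = 0 := hm03 (by decide) (by decide)
      have hv : v = 0 := hm23 (by decide) (by decide)
      rw [hx, hv] at hsum'
      have : y = 0 := by simpa [g1] using hsum'
      exact ⟨hx.trans this.symm, hx.trans hv.symm⟩
    · have hx : x = 0 := hm03 (by decide) (by decide)
      have hy : y = 0 := hm13 (by decide) (by decide)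
      rw [hx, hy] at hsum'
      have : v = 0 := by simpa [g2] using hsum'
      exact ⟨hx.trans hy.symm, hx.trans this.symm⟩
    · exact ⟨hm01 (by decide) (by decide), hm02 (by decide) (by decide)⟩
  obtain ⟨rfl, rfl⟩ := hxy
  by_cases hx : x = 0
  · exact eqm hx hx hz
  · refine tr ?_ x hx l0 l1 l2 l3
    have : x * (γ 0 + γ 1 + γ 2) = 0 := by linear_combination hsum'
    exact (mul_eq_zero.1 this).resolve_left hx

/-- All the products `(z_i - z_j)(w_i - w_j)` are finite. -/
theorem finite_sub_mul_sub (h : IsSystem G z w) (W : Weights P G γ) (i j : Fin 4) :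
    ∃ c, P.Lim ((z i - z j) * (w i - w j)) c := by
  obtain ⟨⟨a, b⟩, hab, hdom⟩ := Place.exists_dominant (P := P)
    (fun p : Fin 4 × Fin 4 => w p.1 - w p.2) ⟨(0, 1), h.w_sub_ne (by decide)⟩
  have ht : (w a - w b)⁻¹ ≠ 0 := inv_ne_zero hab
  have h' := h.scale hab
  have hd : ∀ i j, ∃ c, P.Lim ((w a - w b)⁻¹ * w i - (w a - w b)⁻¹ * w j) c := by
    intro i j
    obtain ⟨c, hc⟩ := hdom (i, j)
    exact ⟨c, Place.congr hc (by rw [← mul_sub, div_eq_inv_mul]) rfl⟩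
  have hω : ∀ n, ∃ c, P.Lim ((w a - w b)⁻¹ * w n) c := by
    intro n
    choose c hc using hd n
    -- The centre of vorticity is at `0`, so `w_n` is the weighted mean of the differences `w_n -
    -- w_j`; finite differences thus give finite positions.
    have l := Place.div (Place.sum Finset.univ fun j _ => P.mul (W.lim j) (hc j))
      (Place.sum Finset.univ fun j _ => W.lim j) W.total
    refine ⟨_, Place.congr l ?_ rfl⟩
    have hG : ∑ j, G j ≠ 0 := Place.ne_zero (Place.sum Finset.univ fun j _ => W.lim j) W.total
    rw [div_eq_iff hG]
    simp only [mul_sub, Finset.sum_sub_distrib]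
    rw [h'.swap.sum_mul_z, sub_zero, ← Finset.sum_mul, mul_comm]
  choose ω hω using hω
  by_cases hz : ∀ n, ∃ c, P.Lim ((w a - w b) * z n) c
  · choose ζ hζ using hz
    refine ⟨_, Place.congr (P.mul (Place.sub (hζ i) (hζ j)) (Place.sub (hω i) (hω j))) ?_ rfl⟩
    rw [← mul_sub, ← mul_sub, mul_mul_mul_comm, mul_inv_cancel₀ hab, one_mul]
  · exfalso
    obtain ⟨m, hm⟩ := exists_triple_collision h' W hω hz
    have e1 : P.Lim ((w a - w b)⁻¹ * w a - (w a - w b)⁻¹ * w b) 1 :=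
      Place.congr Place.one (by rw [← mul_sub, inv_mul_cancel₀ hab]) rfl
    have hne : ω a - ω b ≠ 0 := by
      rw [P.unique (Place.sub (hω a) (hω b)) e1]; exact one_ne_zero
    obtain ⟨p, q, r, hpq, hpr, hpm, hqr, hqm, hrm⟩ : ∃ p q r : Fin 4,
        p ≠ q ∧ p ≠ r ∧ p ≠ m ∧ q ≠ r ∧ q ≠ m ∧ r ≠ m := by
      clear * -
      revert m
      decide
    -- The fourth point stays apart because the dominant difference has been scaled to `1`.
    have hpm' : ω p ≠ ω m := by
      intro e
      have hall : ∀ n, ω n = ω m := by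
        intro n
        by_cases hn : n = m
        · rw [hn]
        · rw [hm n p hn hpm, e]
      exact hne (by rw [hall a, hall b, sub_self])
    have epq := hm p q hpm hqm
    have epr := hm p r hpm hrm
    obtain ⟨σ, rfl, rfl, rfl, rfl⟩ := exists_perm hpq hpr hpm hqr hqm hrm
    refine not_triple_collision_aux (h'.perm σ) (W.perm σ) (ω := ω ∘ σ) (fun n => hω _) epq epr
      hpm' fun hf => hz fun n => ?_
    obtain ⟨c, hc⟩ := hf (σ.symm n)
    exact ⟨c, by simpa using hc⟩

end FourVortex

/-! ### From finiteness at every place to finitely many values -/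

namespace FourVortex

/-- A function on an index set with infinitely many complex values gives, in the field of germs along
a suitable ultrafilter, an element that is not algebraic over the reals. -/
theorem exists_ultrafilter_not_isIntegral {S : Type*} (f : S → ℂ) (hf : (Set.range f).Infinite) :
    ∃ φ : Ultrafilter S,
      letI : Algebra ℝ (Filter.Germ (φ : Filter S) ℂ) :=
        ((Filter.Germ.coeRingHom (φ : Filter S)).comp
          ((Pi.constRingHom S ℂ).comp (algebraMap ℝ ℂ))).toAlgebra
      ¬ IsIntegral ℝ (f : Filter.Germ (φ : Filter S) ℂ) := by
  -- Along an ultrafilter finer than this filter, `f` eventually avoids every finite set, in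
  -- particular the roots of any given monic real polynomial.
  have hne : (Filter.comap f Filter.cofinite).NeBot := by
    rw [Filter.comap_neBot_iff]
    intro t ht
    by_contra hcon
    push Not at hcon
    refine hf ((Filter.mem_cofinite.1 ht).subset ?_)
    rintro _ ⟨a, rfl⟩
    exact hcon a
  refine ⟨Ultrafilter.of (Filter.comap f Filter.cofinite), ?_⟩
  set φ := Ultrafilter.of (Filter.comap f Filter.cofinite) with hφ
  let _ : Algebra ℝ (Filter.Germ (φ : Filter S) ℂ) :=
    ((Filter.Germ.coeRingHom (φ : Filter S)).comp
      ((Pi.constRingHom S ℂ).comp (algebraMap ℝ ℂ))).toAlgebra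
  rintro ⟨p, hp, hpf⟩
  have h1 : Filter.Germ.coeRingHom (φ : Filter S)
      (p.eval₂ ((Pi.constRingHom S ℂ).comp (algebraMap ℝ ℂ)) f) = 0 := by
    rw [Polynomial.hom_eval₂]; exact hpf
  have h2 : ∀ᶠ s in (φ : Filter S),
      p.eval₂ ((Pi.constRingHom S ℂ).comp (algebraMap ℝ ℂ)) f s = 0 :=
    Filter.Germ.coe_eq.1 h1
  have h3 : ∀ s, p.eval₂ ((Pi.constRingHom S ℂ).comp (algebraMap ℝ ℂ)) f s =
      (p.map (algebraMap ℝ ℂ)).eval (f s) := by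
    intro s
    have := Polynomial.hom_eval₂ p ((Pi.constRingHom S ℂ).comp (algebraMap ℝ ℂ))
      (Pi.evalRingHom (fun _ => ℂ) s) f
    rw [Polynomial.eval_map]
    exact this
  have hp0 : p.map (algebraMap ℝ ℂ) ≠ 0 := (hp.map _).ne_zero
  have hfin : {c : ℂ | (p.map (algebraMap ℝ ℂ)).eval c = 0}.Finite :=
    (p.map (algebraMap ℝ ℂ)).rootSet_finite ℂ |>.subset (by
      intro c hc
      rw [Polynomial.mem_rootSet]
      exact ⟨hp0, by simpa using hc⟩)
  have h4 : ∀ᶠ s in (φ : Filter S), f s ∉ {c : ℂ | (p.map (algebraMap ℝ ℂ)).eval c = 0} :=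
    Ultrafilter.of_le _ (Filter.preimage_mem_comap hfin.compl_mem_cofinite)
  obtain ⟨s, hs, hs'⟩ := (h2.and h4).exists
  exact hs' (by rw [Set.mem_ofPred_eq, ← h3, hs])

/-- An element of a field over the reals that is not algebraic is infinite at some place. -/
theorem exists_place_not_finite.{u} {K : Type u} [Field K] [Algebra ℝ K] {x : K}
    (hx : ¬ IsIntegral ℝ x) :
    ∃ (k : Type u) (_ : Field k) (_ : Algebra ℝ k) (P : Place K k), ∀ c, ¬ P.Lim x c := by
  -- An integrally closed subring is an intersection of valuation rings, so one of them omits `x`.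
  obtain ⟨V, hV, hxV⟩ := Subring.exists_le_valuationSubring_of_isIntegrallyClosedIn
    (x := x) (R := (integralClosure ℝ K).toSubring) hx
  let φ : ℝ →+* V := (algebraMap ℝ K).codRestrict V fun r =>
    hV ((integralClosure ℝ K).algebraMap_mem r)
  refine ⟨IsLocalRing.ResidueField V, inferInstance, ((IsLocalRing.residue V).comp φ).toAlgebra,
    placeOfValuationSubring V φ fun r => rfl, ?_⟩
  rintro c ⟨y, rfl, -⟩
  exact hxV y.2

/-- In a family of solutions over `ℂ` the products `(z_i - z_j)(w_i - w_j)` take finitely many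
values. -/
theorem finite_range_sub_mul_sub {S : Type*} {Γ : Fin 4 → ℝ} (hne : ∀ i, Γ i ≠ 0)
    (htot : ∑ i, Γ i ≠ 0) (z w : S → Fin 4 → ℂ)
    (h : ∀ s, IsSystem (fun i => (Γ i : ℂ)) (z s) (w s)) (i j : Fin 4) :
    (Set.range fun s => (z s i - z s j) * (w s i - w s j)).Finite := by
  by_contra hinf
  obtain ⟨φ, hφ⟩ := exists_ultrafilter_not_isIntegral _ hinf
  let _ : Algebra ℝ (Filter.Germ (φ : Filter S) ℂ) :=
    ((Filter.Germ.coeRingHom (φ : Filter S)).comp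
      ((Pi.constRingHom S ℂ).comp (algebraMap ℝ ℂ))).toAlgebra
  obtain ⟨k, _, _, P, hP⟩ := exists_place_not_finite hφ
  have inj : ∀ u : S → Fin 4 → ℂ, (∀ s, Function.Injective (u s)) → Function.Injective
      (fun n => ((fun s => u s n : S → ℂ) : Filter.Germ (φ : Filter S) ℂ)) := by
    intro u hu a b hab
    have : ∀ᶠ s in (φ : Filter S), u s a = u s b := Filter.Germ.coe_eq.1 hab
    obtain ⟨s, hs⟩ := this.exists
    exact hu s hs
  have eqn : ∀ u v : S → Fin 4 → ℂ,
      (∀ s n, u s n = ∑ j, (Γ j : ℂ) * (v s n - v s j)⁻¹) → ∀ n,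
      ((fun s => u s n : S → ℂ) : Filter.Germ (φ : Filter S) ℂ) =
        ∑ j, algebraMap ℝ (Filter.Germ (φ : Filter S) ℂ) (Γ j) *
          (((fun s => v s n : S → ℂ) : Filter.Germ (φ : Filter S) ℂ) -
            ((fun s => v s j : S → ℂ) : Filter.Germ (φ : Filter S) ℂ))⁻¹ := by
    intro u v huv n
    rw [Fin.sum_univ_four]
    have : (fun s => u s n) = fun s => (Γ 0 : ℂ) * (v s n - v s 0)⁻¹ +
        (Γ 1 : ℂ) * (v s n - v s 1)⁻¹ + (Γ 2 : ℂ) * (v s n - v s 2)⁻¹ +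
        (Γ 3 : ℂ) * (v s n - v s 3)⁻¹ := by
      funext s; rw [huv s n, Fin.sum_univ_four]
    rw [this]
    rfl
  have hsys : IsSystem (fun i => algebraMap ℝ (Filter.Germ (φ : Filter S) ℂ) (Γ i))
      (fun n => ((fun s => z s n : S → ℂ) : Filter.Germ (φ : Filter S) ℂ))
      (fun n => ((fun s => w s n : S → ℂ) : Filter.Germ (φ : Filter S) ℂ)) :=
    ⟨inj z fun s => (h s).z_inj, inj w fun s => (h s).w_inj, eqn z w fun s => (h s).eq_z,
      eqn w z fun s => (h s).eq_w⟩
  obtain ⟨c, hc⟩ := finite_sub_mul_sub hsys (weights_of_real P hne htot) i j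
  exact hP c hc

end FourVortex

/-! ### Recovering a normalized solution from its products -/

namespace FourVortex

theorem finite_setOf_quadratic {F : Type*} [Field F] {a : F} (ha : a ≠ 0) (b c : F) :
    {x : F | a * x ^ 2 + b * x + c = 0}.Finite := by
  by_cases h : ∃ r, a * r ^ 2 + b * r + c = 0
  · obtain ⟨r, hr⟩ := h
    refine (Set.toFinite {r, -b / a - r}).subset fun x hx => ?_
    have hx' : a * x ^ 2 + b * x + c = 0 := hx
    have h1 : (x - r) * (a * (x + r) + b) = 0 := by linear_combination hx' - hr
    rcases mul_eq_zero.1 h1 with h2 | h2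
    · exact Or.inl (sub_eq_zero.1 h2)
    · right
      change x = -b / a - r
      field_simp
      linear_combination h2
  · push Not at h
    refine Set.finite_empty.subset fun x hx => h x hx

/-- The third side of a triangle takes finitely many values if the first side and the products of
corresponding sides do. -/
theorem finite_third_side {T D : Set ℂ} (hT : T.Finite) (hD : D.Finite) :
    {x : ℂ | ∃ a ∈ D, ∃ s ∈ T, ∃ s' ∈ T, ∃ s'' ∈ T, s ≠ 0 ∧
      s' * a * (x - a) = s'' * a * x + s * x * (x - a)}.Finite := by
  have : {x : ℂ | ∃ a ∈ D, ∃ s ∈ T, ∃ s' ∈ T, ∃ s'' ∈ T, s ≠ 0 ∧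
      s' * a * (x - a) = s'' * a * x + s * x * (x - a)} =
      ⋃ a ∈ D, ⋃ s ∈ T, ⋃ s' ∈ T, ⋃ s'' ∈ T,
        {x : ℂ | s ≠ 0 ∧ s' * a * (x - a) = s'' * a * x + s * x * (x - a)} := by
    ext x
    simp only [Set.mem_iUnion, exists_prop]
    rfl
  rw [this]
  refine hD.biUnion fun a _ => hT.biUnion fun s _ => hT.biUnion fun s' _ => hT.biUnion fun s'' _ => ?_
  by_cases hs : s = 0
  · exact Set.finite_empty.subset fun x hx => hx.1 hs
  · refine (finite_setOf_quadratic hs (s'' * a - s * a - s' * a) (s' * a * a)).subset fun x hx => ?_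
    have := hx.2
    change s * x ^ 2 + (s'' * a - s * a - s' * a) * x + s' * a * a = 0
    linear_combination -this

/-- The solutions with `z_1 - z_0 = ε (w_1 - w_0)` are finite in number. -/
theorem finite_normalized_systems {Γ : Fin 4 → ℝ} (hne : ∀ i, Γ i ≠ 0) (htot : ∑ i, Γ i ≠ 0)
    (ε : ℂ) :
    {q : (Fin 4 → ℂ) × (Fin 4 → ℂ) | IsSystem (fun i => (Γ i : ℂ)) q.1 q.2 ∧
      q.1 1 - q.1 0 = ε * (q.2 1 - q.2 0)}.Finite := by
  set S := {q : (Fin 4 → ℂ) × (Fin 4 → ℂ) | IsSystem (fun i => (Γ i : ℂ)) q.1 q.2 ∧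
      q.1 1 - q.1 0 = ε * (q.2 1 - q.2 0)} with hS
  obtain ⟨T, hTfin, hT⟩ : ∃ T : Set ℂ, T.Finite ∧ ∀ q ∈ S, ∀ i j,
      (q.1 i - q.1 j) * (q.2 i - q.2 j) ∈ T := by
    refine ⟨⋃ i, ⋃ j, Set.range fun q : S => (q.1.1 i - q.1.1 j) * (q.1.2 i - q.1.2 j),
      Set.finite_iUnion fun i => Set.finite_iUnion fun j =>
        finite_range_sub_mul_sub hne htot (fun q : S => q.1.1) (fun q : S => q.1.2)
          (fun q => q.2.1) i j, fun q hq i j => ?_⟩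
    exact Set.mem_iUnion_of_mem i (Set.mem_iUnion_of_mem j ⟨⟨q, hq⟩, rfl⟩)
  have hDfin : (⋃ s ∈ T, {x : ℂ | 1 * x ^ 2 + 0 * x + -(ε * s) = 0}).Finite :=
    hTfin.biUnion fun s _ => finite_setOf_quadratic one_ne_zero _ _
  set D := ⋃ s ∈ T, {x : ℂ | 1 * x ^ 2 + 0 * x + -(ε * s) = 0}
  have hD : ∀ q ∈ S, q.1 1 - q.1 0 ∈ D := by
    intro q hq
    refine Set.mem_biUnion (hT q hq 1 0) ?_
    change 1 * (q.1 1 - q.1 0) ^ 2 + 0 * (q.1 1 - q.1 0) +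
      -(ε * ((q.1 1 - q.1 0) * (q.2 1 - q.2 0))) = 0
    linear_combination (q.1 1 - q.1 0) * hq.2
  have hXfin := finite_third_side hTfin hDfin
  set X := {x : ℂ | ∃ a ∈ D, ∃ s ∈ T, ∃ s' ∈ T, ∃ s'' ∈ T, s ≠ 0 ∧
      s' * a * (x - a) = s'' * a * x + s * x * (x - a)}
  have hX : ∀ q ∈ S, ∀ i, q.1 i - q.1 0 ∈ X := by
    intro q hq i
    -- With `a = z_1 - z_0` and `x = z_i - z_0`, the relation is `w_i - w_0 = (w_i - w_1) + (w_1 -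
    -- w_0)` with each difference written as product over `z`-side and denominators cleared, a form
    -- that also covers `i = 0` and `i = 1`. Its leading coefficient in `x` is the nonzero product
    -- of the side `01`.
    refine ⟨_, hD q hq, _, hT q hq 1 0, _, hT q hq i 0, _, hT q hq i 1,
      mul_ne_zero (hq.1.z_sub_ne (by decide)) (hq.1.w_sub_ne (by decide)), ?_⟩
    ring
  refine Set.Finite.of_finite_image (f := fun q : (Fin 4 → ℂ) × (Fin 4 → ℂ) =>
    fun i : Fin 4 => q.1 i - q.1 0) ((Set.Finite.pi fun _ : Fin 4 => hXfin).subset ?_) ?_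
  · rintro _ ⟨q, hq, rfl⟩ i -
    exact hX q hq i
  -- The differences determine `z` because `∑ Γ_n z_n = 0` and the total is nonzero, and `z`
  -- determines `w` by its equations.
  · intro q hq q' hq' e
    have e' : ∀ i, q.1 i - q.1 0 = q'.1 i - q'.1 0 := fun i => congrFun e i
    have s1 := hq.1.sum_mul_z
    have s2 := hq'.1.sum_mul_z
    have hz0 : q.1 0 = q'.1 0 := by
      have hc : (∑ i, (Γ i : ℂ)) ≠ 0 := by exact_mod_cast htot
      have : (∑ i, (Γ i : ℂ)) * (q.1 0 - q'.1 0) = 0 := by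
        rw [Fin.sum_univ_four] at s1 s2 ⊢
        linear_combination s1 - s2 - (Γ 1 : ℂ) * e' 1 - (Γ 2 : ℂ) * e' 2 - (Γ 3 : ℂ) * e' 3
      exact sub_eq_zero.1 ((mul_eq_zero.1 this).resolve_left hc)
    have hz : q.1 = q'.1 := by
      funext i; linear_combination e' i + hz0
    refine Prod.ext hz ?_
    funext n
    rw [hq.1.eq_w n, hq'.1.eq_w n, hz]

/-! ### The virial identity and the reduction of configurations to solutions -/

theorem angularMomentum_four (Γ : Fin 4 → ℝ) : angularMomentum Γ =
    Γ 0 * Γ 1 + Γ 0 * Γ 2 + Γ 0 * Γ 3 + Γ 1 * Γ 2 + Γ 1 * Γ 3 + Γ 2 * Γ 3 := by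
  have h0 : Finset.Ioi (0 : Fin 4) = {1, 2, 3} := by decide
  have h1 : Finset.Ioi (1 : Fin 4) = {2, 3} := by decide
  have h2 : Finset.Ioi (2 : Fin 4) = {3} := by decide
  have h3 : Finset.Ioi (3 : Fin 4) = ∅ := by decide
  simp [angularMomentum, Fin.sum_univ_four, h0, h1, h2, h3]
  ring

/-- The virial identity. -/
theorem sum_mul_sum_inv (Γ : Fin 4 → ℝ) {x : Fin 4 → ℂ} (hx : Function.Injective x) :
    ∑ n, (Γ n : ℂ) * x n * ∑ j, (Γ j : ℂ) * (x n - x j)⁻¹ = (angularMomentum Γ : ℂ) := by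
  have flip : ∀ i j, (x j - x i)⁻¹ = -(x i - x j)⁻¹ := fun i j => by rw [← inv_neg, neg_sub]
  have c : ∀ i j, i ≠ j → (x i - x j) * (x i - x j)⁻¹ = 1 := fun i j hij =>
    mul_inv_cancel₀ (sub_ne_zero.2 fun e => hij (hx e))
  rw [angularMomentum_four]
  simp only [Fin.sum_univ_four, sub_self, inv_zero]
  rw [flip 0 1, flip 0 2, flip 0 3, flip 1 2, flip 1 3, flip 2 3]
  push_cast
  linear_combination (Γ 0 : ℂ) * Γ 1 * c 0 1 (by decide) + (Γ 0 : ℂ) * Γ 2 * c 0 2 (by decide) +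
    (Γ 0 : ℂ) * Γ 3 * c 0 3 (by decide) + (Γ 1 : ℂ) * Γ 2 * c 1 2 (by decide) +
    (Γ 1 : ℂ) * Γ 3 * c 1 3 (by decide) + (Γ 2 : ℂ) * Γ 3 * c 2 3 (by decide)

/-- On the diagonal antisymmetry gives `0`, which is also the inverse of `0`. -/
theorem eq_inv_of_antisymm {x : Fin 4 → ℂ} {X : Fin 4 → Fin 4 → ℂ}
    (hmul : ∀ j k, j < k → X j k * (x k - x j) = 1) (hanti : ∀ j k, X j k = -X k j) (j k : Fin 4) :
    X j k = (x k - x j)⁻¹ := by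
  rcases lt_trichotomy j k with h | rfl | h
  · exact eq_inv_of_mul_eq_one_left (hmul j k h)
  · rw [sub_self, inv_zero]
    have := hanti j j
    linear_combination this / 2
  · rw [hanti, eq_inv_of_mul_eq_one_left (hmul k j h), ← inv_neg, neg_sub]

theorem sum_erase_eq (Γ : Fin 4 → ℝ) (x : Fin 4 → ℂ) (n : Fin 4) :
    ∑ j ∈ Finset.univ.erase n, (Γ j : ℂ) * (x n - x j)⁻¹ = ∑ j, (Γ j : ℂ) * (x n - x j)⁻¹ :=
  Finset.sum_erase _ (by simp)

/-- The normalized configuration determined by the sign `ε` of the multiplier and by `z`, `w`. -/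
noncomputable def configurationOfSystem (ε : ℂ) (q : (Fin 4 → ℂ) × (Fin 4 → ℂ)) :
    ℂ × ComplexConfiguration :=
  (ε, ⟨fun n => ε * q.1 n, fun j k => (q.2 k - q.2 j)⁻¹, q.2,
    fun j k => (ε * q.1 k - ε * q.1 j)⁻¹⟩)

/-- The virial identity applied to `z` and to `w` gives `Λ I = L = conj Λ * I` with `L ≠ 0`, so `Λ`
is real of modulus one. Replacing `z` by `Λ z` removes it from both equations, and `Λ² = 1` makes
this reversible. -/
theorem exists_system_of_normalized {Γ : Fin 4 → ℝ} (hL : angularMomentum Γ ≠ 0) {Λ : ℂ}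
    {Q : ComplexConfiguration} (h : IsNormalizedCentralConfiguration Γ Λ Q) :
    ∃ ε : ℂ, (ε = 1 ∨ ε = -1) ∧ ∃ q : (Fin 4 → ℂ) × (Fin 4 → ℂ),
      (IsSystem (fun i => (Γ i : ℂ)) q.1 q.2 ∧ q.1 1 - q.1 0 = ε * (q.2 1 - q.2 0)) ∧
      configurationOfSystem ε q = (Λ, Q) := by
  have hZ := eq_inv_of_antisymm h.Z_mul h.Z_antisymm
  have hW := eq_inv_of_antisymm h.W_mul h.W_antisymm
  have ne_of_lt_z : ∀ j k, j < k → Q.z j ≠ Q.z k := fun j k hjk e => by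
    simpa [e] using h.W_mul j k hjk
  have ne_of_lt_w : ∀ j k, j < k → Q.w j ≠ Q.w k := fun j k hjk e => by
    simpa [e] using h.Z_mul j k hjk
  have z_inj : Function.Injective Q.z := fun a b e => by
    by_contra hab
    rcases lt_or_gt_of_ne hab with hlt | hlt
    exacts [ne_of_lt_z _ _ hlt e, ne_of_lt_z _ _ hlt e.symm]
  have w_inj : Function.Injective Q.w := fun a b e => by
    by_contra hab
    rcases lt_or_gt_of_ne hab with hlt | hlt
    exacts [ne_of_lt_w _ _ hlt e, ne_of_lt_w _ _ hlt e.symm]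
  have eq_z : ∀ n, Λ * Q.z n = ∑ j, (Γ j : ℂ) * (Q.w n - Q.w j)⁻¹ := fun n => by
    rw [h.eq_z n, ← sum_erase_eq]; simp only [hZ]
  have eq_w : ∀ n, conj Λ * Q.w n = ∑ j, (Γ j : ℂ) * (Q.z n - Q.z j)⁻¹ := fun n => by
    rw [h.eq_w n, ← sum_erase_eq]; simp only [hW]
  have v1 := sum_mul_sum_inv Γ w_inj
  have v2 := sum_mul_sum_inv Γ z_inj
  simp only [← eq_z] at v1
  simp only [← eq_w] at v2
  have hL' : (angularMomentum Γ : ℂ) ≠ 0 := by exact_mod_cast hL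
  obtain ⟨I, hI⟩ : ∃ I, I = ∑ n, (Γ n : ℂ) * Q.z n * Q.w n := ⟨_, rfl⟩
  have v1' : Λ * I = angularMomentum Γ := by
    rw [← v1, hI, Finset.mul_sum]; exact Finset.sum_congr rfl fun n _ => by ring
  have v2' : conj Λ * I = angularMomentum Γ := by
    rw [← v2, hI, Finset.mul_sum]; exact Finset.sum_congr rfl fun n _ => by ring
  have hI0 : I ≠ 0 := by
    rintro rfl; rw [mul_zero] at v1'; exact hL' v1'.symm
  have hreal : conj Λ = Λ := mul_right_cancel₀ hI0 (v2'.trans v1'.symm)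
  have hsq : Λ * Λ = 1 := by
    have := Complex.mul_conj Λ
    rw [hreal, Complex.normSq_eq_norm_sq, h.norm_multiplier] at this
    simpa using this
  have hΛ : Λ = 1 ∨ Λ = -1 := mul_self_eq_one_iff.1 hsq
  have hΛ0 : Λ ≠ 0 := by rintro rfl; simp at hsq
  refine ⟨Λ, hΛ, (fun n => Λ * Q.z n, Q.w), ⟨⟨(mul_right_injective₀ hΛ0).comp z_inj, w_inj, eq_z,
    fun n => ?_⟩, ?_⟩, ?_⟩
  · have e := eq_w n
    rw [hreal] at e
    have hinv : Λ⁻¹ = Λ := inv_eq_of_mul_eq_one_left hsq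
    have : ∀ j, (Γ j : ℂ) * (Λ * Q.z n - Λ * Q.z j)⁻¹ = Λ * ((Γ j : ℂ) * (Q.z n - Q.z j)⁻¹) :=
      fun j => by rw [← mul_sub, mul_inv, hinv]; ring
    simp only [this]
    rw [← Finset.mul_sum, ← e, ← mul_assoc, hsq, one_mul]
  · linear_combination Λ * h.rotation_normalized
  · have hz : ∀ n, Λ * (Λ * Q.z n) = Q.z n := fun n => by rw [← mul_assoc, hsq, one_mul]
    refine Prod.ext rfl (ComplexConfiguration.ext ?_ ?_ rfl ?_)
    · funext n; exact hz n
    · funext j k; exact (hZ j k).symm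
    · funext j k
      change (Λ * (Λ * Q.z k) - Λ * (Λ * Q.z j))⁻¹ = _
      rw [hz, hz, hW]

theorem V_eq_sum (Γ : Fin 4 → ℝ) (z : Fin 4 → ℂ) (c : ℂ) (n : Fin 4) :
    V Γ z n = ∑ j, (Γ j : ℂ) * (conj (z n - c) - conj (z j - c))⁻¹ := by
  rw [← sum_erase_eq Γ (fun n => conj (z n - c)), V]
  refine Finset.sum_congr rfl fun j _ => ?_
  rw [div_eq_mul_inv, ← map_sub]
  congr 3
  ring

/-- The virial identity equates `Λ` times a real number with the nonzero real number `L`. -/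
theorem not_isCollapseConfiguration {Γ : Fin 4 → ℝ} (hL : angularMomentum Γ ≠ 0) (z : Fin 4 → ℂ) :
    ¬ IsCollapseConfiguration Γ z := by
  rintro ⟨hinj, Λ, c, hΛ, hV⟩
  have hx : Function.Injective fun n => conj (z n - c) := fun a b hab =>
    hinj (sub_left_injective (RingHom.injective (starRingEnd ℂ) hab))
  have v := sum_mul_sum_inv Γ hx
  simp only [← V_eq_sum, hV] at v
  have hI : ∑ n, (Γ n : ℂ) * conj (z n - c) * (Λ * (z n - c)) =
      Λ * ((∑ n, Γ n * Complex.normSq (z n - c) : ℝ) : ℂ) := by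
    push_cast
    rw [Finset.mul_sum]
    refine Finset.sum_congr rfl fun n _ => ?_
    rw [← Complex.mul_conj]; ring
  rw [hI] at v
  have him := congrArg Complex.im v
  have hre := congrArg Complex.re v
  rw [Complex.im_mul_ofReal, Complex.ofReal_im] at him
  rw [(mul_eq_zero.1 him).resolve_left hΛ] at hre
  simp at hre
  exact hL hre.symm

/-- With `y = z - c`, the pair `(u y, (r / u) conj y)` solves the system for every `u ≠ 0`. Choosing
`u² = r conj (z_1 - z_0) / (z_1 - z_0)` achieves the normalization; as `u` is complex, both signs of
`r` are covered. -/
theorem exists_system_of_relativeEquilibrium {Γ : Fin 4 → ℝ} {z : Fin 4 → ℂ}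
    (h : IsRelativeEquilibrium Γ z) :
    ∃ q : (Fin 4 → ℂ) × (Fin 4 → ℂ),
      (IsSystem (fun i => (Γ i : ℂ)) q.1 q.2 ∧ q.1 1 - q.1 0 = 1 * (q.2 1 - q.2 0)) ∧
      Equivalent q.1 z := by
  obtain ⟨hinj, r, c, hr, hV⟩ := h
  have hr' : (r : ℂ) ≠ 0 := by exact_mod_cast hr
  have d0 : z 1 - z 0 ≠ 0 := sub_ne_zero.2 fun e => absurd (hinj e) (by decide)
  have d0' : conj (z 1 - z 0) ≠ 0 := (map_ne_zero _).2 d0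
  obtain ⟨u, hu⟩ := IsAlgClosed.exists_pow_nat_eq ((r : ℂ) * conj (z 1 - z 0) / (z 1 - z 0))
    (n := 2) (by norm_num)
  have hu0 : u ≠ 0 := by
    rintro rfl
    exact div_ne_zero (mul_ne_zero hr' d0') d0 (by rw [← hu]; norm_num)
  have hy : Function.Injective fun n => z n - c := fun a b hab => hinj (sub_left_injective hab)
  have hx : Function.Injective fun n => conj (z n - c) := fun a b hab =>
    hy (RingHom.injective (starRingEnd ℂ) hab)
  have e1 : ∀ n, (r : ℂ) * (z n - c) = ∑ j, (Γ j : ℂ) * (conj (z n - c) - conj (z j - c))⁻¹ :=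
    fun n => by rw [← hV, V_eq_sum Γ z c]
  have e2 : ∀ n, (r : ℂ) * conj (z n - c) = ∑ j, (Γ j : ℂ) * ((z n - c) - (z j - c))⁻¹ := by
    intro n
    have := congrArg conj (e1 n)
    simpa [map_sum] using this
  have ht0 : (r : ℂ) / u ≠ 0 := div_ne_zero hr' hu0
  refine ⟨(fun n => u * (z n - c), fun n => r / u * conj (z n - c)),
    ⟨⟨(mul_right_injective₀ hu0).comp hy, (mul_right_injective₀ ht0).comp hx, fun n => ?_,
      fun n => ?_⟩, ?_⟩, ?_⟩
  · have : ∀ j, (Γ j : ℂ) * (r / u * conj (z n - c) - r / u * conj (z j - c))⁻¹ =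
        u / r * ((Γ j : ℂ) * (conj (z n - c) - conj (z j - c))⁻¹) := fun j => by
      rw [← mul_sub, mul_inv, inv_div]; ring
    simp only [this]
    rw [← Finset.mul_sum, ← e1]
    field_simp
  · have : ∀ j, (Γ j : ℂ) * (u * (z n - c) - u * (z j - c))⁻¹ =
        u⁻¹ * ((Γ j : ℂ) * ((z n - c) - (z j - c))⁻¹) := fun j => by
      rw [← mul_sub, mul_inv]; ring
    simp only [this]
    rw [← Finset.mul_sum, ← e2]
    field_simp
  · have hu' : u ^ 2 * (z 1 - z 0) = r * conj (z 1 - z 0) := by rw [hu]; field_simp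
    have hu'' : u * (z 1 - z 0) = r / u * conj (z 1 - z 0) := by
      field_simp; exact hu'
    simp only [map_sub] at hu'' ⊢
    linear_combination hu''
  · refine ⟨u * c, u⁻¹, inv_ne_zero hu0, fun n => ?_⟩
    field_simp
    ring

end FourVortex

theorem theorem6p5 (Γ : Fin 4 → ℝ) (hne : ∀ n, Γ n ≠ 0)
    (htot : FourVortex.totalVorticity Γ ≠ 0)
    (hL : FourVortex.angularMomentum Γ ≠ 0)
    (hexc : ¬ ∃ i, ∀ j, j ≠ i → Γ j = -(1 / 2) * Γ i) :
    {p : ℂ × FourVortex.ComplexConfiguration |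
        FourVortex.IsNormalizedCentralConfiguration Γ p.1 p.2}.Finite ∧
      (Quotient.mk (FourVortex.configurationSetoid 4) ''
        {z | FourVortex.IsCentralConfiguration Γ z}).Finite := by
  -- The hypothesis `hexc` is not needed: the finiteness holds for those vorticities as well.
  have fin : ∀ ε : ℂ, _ := FourVortex.finite_normalized_systems hne htot
  constructor
  · refine (((fin 1).image (FourVortex.configurationOfSystem 1)).union
      ((fin (-1)).image (FourVortex.configurationOfSystem (-1)))).subset ?_
    rintro ⟨Λ, Q⟩ h
    obtain ⟨ε, rfl | rfl, q, hq, e⟩ := FourVortex.exists_system_of_normalized hL h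
    · exact Or.inl ⟨q, hq, e⟩
    · exact Or.inr ⟨q, hq, e⟩
  · refine ((fin 1).image fun q => Quotient.mk (FourVortex.configurationSetoid 4) q.1).subset ?_
    rintro _ ⟨z, hz, rfl⟩
    rcases hz with hz | hz
    · obtain ⟨q, hq, e⟩ := FourVortex.exists_system_of_relativeEquilibrium hz
      exact ⟨q, hq, Quotient.sound e⟩
    · exact absurd hz (FourVortex.not_isCollapseConfiguration hL z)
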